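/- **Theorem (Computational bound).** For integers $\mu\ge 1$, $r\ge 0$ and a prime $p$ let $$I_{1/p}(r,\mu)=\Big(1-\frac1p\Big)^{\mu}\sum_{j\ge r}\binom{\mu+j-1}{j}p^{-j}$$ be the regularized beta function. An *item* is a pair $(p,r)$ with $p$ prime and $r\ge 1$; its value, weight and density are $$\mathrm{val}(p,r)=\log_2 p,\qquad \mathrm{weight}(p,r)=\log_2 I_{1/p}(r-1,\mu)-\log_2 I_{1/p}(r,\mu),\qquad \mathrm{density}(p,r)=\frac{\mathrm{val}(p,r)}{\mathrm{weight}(p,r)}.$$ For an integer $\lambda\ge 0$ let $t(\lambda,\mu)$ be the supremum of all positive integers $N=\prod_i p_i^{r_i}$ (distinct primes $p_i$, $r_i\ge1$) with $\prod_i I_{1/p_i}(r_i,\mu)\ge 2^{-\lambda}$. *Greedy algorithm* on input $(\lambda,\mu)$: put $v=w=0$, $p_{\max}=2$, and let $H$ be a max-heap, keyed by density, containing only $(2,1)$. While $w<\lambda$: pop an item $(p,r)$ of maximal density from $H$ (ties are broken arbitrarily); push $(p,r+1)$; add $\mathrm{val}(p,r)$ to $v$ and $\mathrm{weight}(p,r)$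 to $w$; if $p=p_{\max}$, replace $p_{\max}$ by the next prime $q$ and push $(q,1)$. Output $v$. *Enumeration scheme* for a function $f:A\times B\to\mathbb R$, where $A,B$ are linearly ordered sets with least elements $a_0,b_0$ in which every non-maximal element $x$ has a next element $x^+$: start with $C=\{(a_0,b_0)\}$ and $\max_A=a_0$; in each iteration remove from $C$ a pair $(a,b)$ with the highest value $f(a,b)$ and append it to the output list; add $(a,b^+)$ to $C$, and if $a=\max_A$ also add $(a^+,b_0)$ to $C$ and set $\max_A:=a^+$ (nothing is added where no next element exists). The following hold. 1. For all integers $\lambda\ge0$ and $\mu\ge1$ the number of iterations of the greedy algorithm is bounded over all its runs, the heap always contains an item to pop, and the algorithm has an output. If $k$ is any output, then every integer $N\ge 2^k$ satisfies $N\ge t(\lambda,\mu)$ (in particular $t(\lambda,\mu)<\infty$), and for every integer $m\ge1$ and every polynomial $f\in\mathbb Z[X_1,\dots,X_\mu]$ of degree at most $1$ in each variable whose content is coprime to $N$, $$\Pr_{x\leftarrow[0,m)^\mu}\big[f(x)\equiv 0 \bmod N\big]\le 2^{-\lambda}+\frac{\mu}{m},$$ where $x$ is uniform on the integer points of $[0,m)^\mu$.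 2. For $\mu\ge1$ all weights are positive, $\mathrm{density}(p,r)$ is non-increasing in $r\ge 1$ for each prime $p$, and strictly decreasing in $r$ if $\mu\ge2$; and $\mathrm{density}(p,1)$ is non-increasing in the prime $p$. 3. If $f(a,b_0)$ is non-increasing in $a$ and, for every fixed $a$, $f(a,b)$ is non-increasing in $b$, then at every stage of the enumeration scheme the output list has no repetitions and is in order of non-increasing $f$, every listed pair has $f$-value at least that of every pair not yet listed, and as long as some pair is not yet listed the set $C$ contains a pair of highest $f$-value, so that the scheme can continue. 4. In particular, for $\mu\ge1$, every run of the greedy algorithm pops pairwise distinct items, in order of non-increasing density, and each popped item has density at least that of every item not yet popped. -/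

import Mathlib

/-- The regularized beta function at integer arguments,
`I_ε(k, μ) = (1 - ε)^μ ∑_{j ≥ k} C(μ + j - 1, j) ε^j`; the summation index is `j = k + i`. -/
noncomputable def regBeta (ε : ℝ) (k μ : ℕ) : ℝ :=
  (1 - ε) ^ μ * ∑' i : ℕ, (Nat.choose (μ + (k + i) - 1) (k + i) : ℝ) * ε ^ (k + i)

/-- The threshold `t(λ, μ)`: the supremum, taken in `ℕ∞`, of all positive integers `N` with
`∏_{p^r ∥ N} I_{1/p}(r, μ) ≥ 2^{-λ}`. -/
noncomputable def threshold (lam μ : ℕ) : ℕ∞ :=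
  ⨆ N ∈ {N : ℕ | 0 < N ∧ (2 : ℝ) ^ (-(lam : ℤ)) ≤
    ∏ p ∈ N.primeFactors, regBeta (1 / (p : ℝ)) (N.factorization p) μ}, (N : ℕ∞)

/-! ### Items of the knapsack: pairs `(p, r)` with `p` prime and `r ≥ 1` -/

/-- The value `log₂ p` of an item `(p, r)`. -/
noncomputable def itemVal (x : ℕ × ℕ) : ℝ := Real.logb 2 x.1

/-- The weight `log₂ I_{1/p}(r - 1, μ) - log₂ I_{1/p}(r, μ)` of an item `(p, r)`, `r ≥ 1`. -/
noncomputable def itemWeight (μ : ℕ) (x : ℕ × ℕ) : ℝ :=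
  Real.logb 2 (regBeta (1 / (x.1 : ℝ)) (x.2 - 1) μ) - Real.logb 2 (regBeta (1 / (x.1 : ℝ)) x.2 μ)

/-- The density of an item: value divided by weight. -/
noncomputable def itemDensity (μ : ℕ) (x : ℕ × ℕ) : ℝ := itemVal x / itemWeight μ x

/-! ### The greedy knapsack algorithm -/

/-- The smallest prime larger than `p`. -/
noncomputable def nextPrime (p : ℕ) : ℕ := sInf {q : ℕ | q.Prime ∧ p < q}

/-- Variables of the greedy algorithm. An entry `(p, r)` of the heap carries the key
`density(p, r)`, which is determined by `(p, r)` and therefore not stored. -/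
structure GreedyState where
  heap : Finset (ℕ × ℕ)
  pmax : ℕ
  v : ℝ
  w : ℝ

/-- The initial values of the variables: the heap holds `(2, 1)` only. -/
noncomputable def greedyInit : GreedyState where
  heap := {(2, 1)}
  pmax := 2
  v := 0
  w := 0

/-- `x` may be popped from the max heap: it is an entry of maximal density. Ties between entries
of equal density may be broken in any way. -/
def IsHeapMax (μ : ℕ) (s : GreedyState) (x : ℕ × ℕ) : Prop :=
  x ∈ s.heap ∧ ∀ y ∈ s.heap, itemDensity μ y ≤ itemDensity μ x

/-- The body of the while loop, when the entry popped from the heap is `x = (p, r)`: push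
`(p, r + 1)`, add value and weight of `(p, r)` to `v` and `w`, and if `p = pmax` advance `pmax` to
the next prime `q` and push `(q, 1)`. -/
noncomputable def greedyNext (μ : ℕ) (s : GreedyState) (x : ℕ × ℕ) : GreedyState where
  heap :=
    if x.1 = s.pmax then
      insert (nextPrime x.1, 1) (insert (x.1, x.2 + 1) (s.heap.erase x))
    else insert (x.1, x.2 + 1) (s.heap.erase x)
  pmax := if x.1 = s.pmax then nextPrime x.1 else s.pmax
  v := s.v + itemVal x
  w := s.w + itemWeight μ x

/-- `GreedyRun lam μ L s`: on input `λ, μ` the algorithm can be in state `s` at the head of the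
loop `while w < λ` after having popped the items of the list `L`, in this order. -/
inductive GreedyRun (lam μ : ℕ) : List (ℕ × ℕ) → GreedyState → Prop
  | init : GreedyRun lam μ [] greedyInit
  | step {L : List (ℕ × ℕ)} {s : GreedyState} {x : ℕ × ℕ} :
      GreedyRun lam μ L s → s.w < lam → IsHeapMax μ s x →
        GreedyRun lam μ (L ++ [x]) (greedyNext μ s x)

/-- `k` is an output of the algorithm on input `λ, μ`: some run leaves the loop with `v = k`. -/
def IsGreedyOutput (lam μ : ℕ) (k : ℝ) : Prop :=
  ∃ L s, GreedyRun lam μ L s ∧ (lam : ℝ) ≤ s.w ∧ s.v = k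

/-! ### The enumeration scheme for pairs from two discrete ordered sets -/

/-- Variables of the enumeration scheme: the candidate set `C` and the element `max_A`. -/
structure EnumState (A B : Type*) where
  C : Set (A × B)
  maxA : A

/-- The effect of removing `x = (a, b)` from `C`: add `(a, b+)` and, if `a = max_A`, also
`(a+, b₀)`, and then advance `max_A` to `a+`. Nothing is added where there is no next element. -/
noncomputable def enumNext {A B : Type*} [LinearOrder A] [OrderBot A] [SuccOrder A]
    [LinearOrder B] [OrderBot B] [SuccOrder B] (s : EnumState A B) (x : A × B) :
    EnumState A B where
  C := (s.C \ {x}) ∪ {y | ¬ IsMax x.2 ∧ y = (x.1, Order.succ x.2)} ∪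
    {y | x.1 = s.maxA ∧ ¬ IsMax x.1 ∧ y = (Order.succ x.1, ⊥)}
  maxA := if x.1 = s.maxA then Order.succ x.1 else s.maxA

/-- `EnumRun f L s`: the enumeration scheme for `f` can be in state `s` after having output the
list `L`. In each iteration a candidate with the highest value of `f` is removed from `C` and
appended to the output. -/
inductive EnumRun {A B : Type*} [LinearOrder A] [OrderBot A] [SuccOrder A]
    [LinearOrder B] [OrderBot B] [SuccOrder B] (f : A × B → ℝ) :
    List (A × B) → EnumState A B → Prop
  | init : EnumRun f [] ⟨{(⊥, ⊥)}, ⊥⟩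
  | step {L : List (A × B)} {s : EnumState A B} {x : A × B} :
      EnumRun f L s → x ∈ s.C → (∀ y ∈ s.C, f y ≤ f x) →
        EnumRun f (L ++ [x]) (enumNext s x)

/-! ### Polynomials -/

/-- A polynomial in `μ` variables is `μ`-linear if it has degree at most 1 in each variable. -/
def IsMuLinear {μ : ℕ} (f : MvPolynomial (Fin μ) ℤ) : Prop :=
  ∀ i, f.degreeOf i ≤ 1

/-- `f` is coprime to `N`: the content of `f` (the gcd of its coefficients) is coprime to `N`. -/
def CoprimeTo {μ : ℕ} (f : MvPolynomial (Fin μ) ℤ) (N : ℕ) : Prop :=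
  IsCoprime (f.support.gcd fun d => f.coeff d) (N : ℤ)

/-- The cube `[0, m)^μ` of integer points. -/
noncomputable def cube (μ m : ℕ) : Finset (Fin μ → ℤ) :=
  Fintype.piFinset fun _ => Finset.Ico (0 : ℤ) m

/-- The probability that `f(x) ≡ 0 mod N` for `x` uniformly distributed over `[0, m)^μ`. -/
noncomputable def zeroProb {μ : ℕ} (f : MvPolynomial (Fin μ) ℤ) (N m : ℕ) : ℝ :=
  (((cube μ m).filter fun x => MvPolynomial.eval x f ≡ 0 [ZMOD N]).card : ℝ) / (cube μ m).card

/-! ### The regularized beta function -/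

/-! `regBeta ε k μ` is the probability that a sum of `μ` independent geometric variables `Y` with
`P(Y ≥ j) = ε ^ j` is at least `k`. The proof joins a Schwartz–Zippel bound modulo `N` with these
tails to a fractional knapsack argument.

Knapsack: for `N > 0` the items `(p, r)` with `p ^ r ∣ N` have total value `log₂ N` and, by
telescoping, total weight `-log₂ ∏ I`. Let `G` be the set of popped items and `d` its least density.
Then `val - d * weight` is nonnegative on `G` and nonpositive off `G`, so for the items `M` of any
`N`, `val M - val G ≤ d * (weight M - weight G)`. As `weight G ≥ λ` at exit, `weight M ≤ λ` gives
`log₂ N ≤ k`, which bounds the threshold. The strict version, read contrapositively, gives `∏ I ≤ 2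
^ (-λ)` whenever `N ≥ 2 ^ k`.

Greedy order: density falls in `r` because the tails are log-concave in `k`, and density at `r = 1`
falls in `p` by a convexity inequality for `x ^ t`. Under such monotonicity, the candidate set
always contains a pair dominating any given unlisted pair. Indexing primes by ℕ makes the greedy
loop an instance of this scheme. It stops because a popped item `(p, r)` forces `I > 2 ^ (-λ)`
before exit, which holds for finitely many items only.

Schwartz–Zippel: induct on the number of variables. Fix the first coordinate, divide out the prime
powers that divide the restricted function everywhere, and average the inductive bound. The joint
tails of the removed exponents are geometric up to one extra point, so averaging adds one geometric
variable to each tail and `1 / m` to the error. -/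

theorem summable_choose_mul_pow {ε : ℝ} (h0 : 0 ≤ ε) (h1 : ε < 1) (μ : ℕ) :
    Summable fun j : ℕ => (Nat.choose (μ + j - 1) j : ℝ) * ε ^ j := by
  rcases μ with _ | n
  · refine summable_of_ne_finset_zero (s := {0}) fun j hj => ?_
    have hj : j ≠ 0 := by simpa using hj
    rw [Nat.choose_eq_zero_of_lt (by omega)]
    simp
  · refine (summable_choose_mul_geometric_of_norm_lt_one n
      (show ‖ε‖ < 1 by rwa [Real.norm_of_nonneg h0])).congr fun j => ?_
    rw [show n + 1 + j - 1 = j + n by omega, Nat.choose_symm_add]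

theorem summable_regBeta_tail {ε : ℝ} (h0 : 0 ≤ ε) (h1 : ε < 1) (k μ : ℕ) :
    Summable fun i : ℕ => (Nat.choose (μ + (k + i) - 1) (k + i) : ℝ) * ε ^ (k + i) := by
  have := (summable_nat_add_iff k).2 (summable_choose_mul_pow h0 h1 μ)
  simpa only [add_comm _ k] using this

theorem regBeta_eq_add {ε : ℝ} (h0 : 0 ≤ ε) (h1 : ε < 1) (k μ : ℕ) :
    regBeta ε k μ =
      (1 - ε) ^ μ * ((Nat.choose (μ + k - 1) k : ℝ) * ε ^ k) + regBeta ε (k + 1) μ := by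
  unfold regBeta
  rw [(summable_regBeta_tail h0 h1 k μ).tsum_eq_zero_add, mul_add]
  simp only [add_zero, add_assoc, add_comm 1]

theorem regBeta_zero {ε : ℝ} (h0 : 0 ≤ ε) (h1 : ε < 1) (μ : ℕ) : regBeta ε 0 μ = 1 := by
  unfold regBeta
  rcases μ with _ | n
  · rw [tsum_eq_single 0 fun j hj => by rw [Nat.choose_eq_zero_of_lt (by omega)]; simp]
    simp
  · have : ∀ j : ℕ, (Nat.choose (n + 1 + (0 + j) - 1) (0 + j) : ℝ) * ε ^ (0 + j) =
        (Nat.choose (j + n) n : ℝ) * ε ^ j := fun j => by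
      rw [show n + 1 + (0 + j) - 1 = j + n by omega, zero_add, Nat.choose_symm_add]
    simp_rw [this]
    rw [tsum_choose_mul_geometric_of_norm_lt_one n
      (show ‖ε‖ < 1 by rwa [Real.norm_of_nonneg h0])]
    have : (1 - ε) ≠ 0 := by linarith
    field_simp

theorem regBeta_one {ε : ℝ} (h0 : 0 ≤ ε) (h1 : ε < 1) (μ : ℕ) :
    regBeta ε 1 μ = 1 - (1 - ε) ^ μ := by
  have := regBeta_eq_add h0 h1 0 μ
  rw [regBeta_zero h0 h1] at this
  simp at this
  linarith

/-- Pascal's rule applied termwise. At `μ = 0` it relies on truncated subtraction: `Nat.choose (j -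
1) j` is `0` for `j ≥ 1`, so the tail for no variables is that of the constant `0`. -/
theorem regBeta_succ_succ {ε : ℝ} (h0 : 0 ≤ ε) (h1 : ε < 1) (k μ : ℕ) :
    regBeta ε (k + 1) (μ + 1) =
      (1 - ε) * regBeta ε (k + 1) μ + ε * regBeta ε k (μ + 1) := by
  unfold regBeta
  have key : ∀ i : ℕ, (Nat.choose (μ + 1 + (k + 1 + i) - 1) (k + 1 + i) : ℝ) * ε ^ (k + 1 + i) =
      (Nat.choose (μ + (k + 1 + i) - 1) (k + 1 + i) : ℝ) * ε ^ (k + 1 + i) +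
      ε * ((Nat.choose (μ + 1 + (k + i) - 1) (k + i) : ℝ) * ε ^ (k + i)) := fun i => by
    rw [show μ + 1 + (k + 1 + i) - 1 = (μ + (k + i)) + 1 by omega,
      show k + 1 + i = (k + i) + 1 by omega, Nat.choose_succ_succ,
      show μ + (k + i + 1) - 1 = μ + (k + i) by omega,
      show μ + 1 + (k + i) - 1 = μ + (k + i) by omega]
    push_cast
    ring
  simp_rw [key]
  rw [(summable_regBeta_tail h0 h1 (k + 1) μ).tsum_add
    ((summable_regBeta_tail h0 h1 k (μ + 1)).mul_left ε), tsum_mul_left]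
  ring

theorem regBeta_succ_le {ε : ℝ} (h0 : 0 ≤ ε) (h1 : ε < 1) (k μ : ℕ) :
    regBeta ε (k + 1) μ ≤ regBeta ε k μ := by
  rw [regBeta_eq_add h0 h1 k μ]
  have : 0 ≤ 1 - ε := by linarith
  have : 0 ≤ (1 - ε) ^ μ * ((Nat.choose (μ + k - 1) k : ℝ) * ε ^ k) := by positivity
  linarith

theorem regBeta_nonneg {ε : ℝ} (h0 : 0 ≤ ε) (h1 : ε < 1) (k μ : ℕ) : 0 ≤ regBeta ε k μ := by
  have : 0 ≤ 1 - ε := by linarith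
  exact mul_nonneg (by positivity) (tsum_nonneg fun i => by positivity)

theorem regBeta_succ_lt {ε : ℝ} (h0 : 0 < ε) (h1 : ε < 1) (k : ℕ) {μ : ℕ} (hμ : 1 ≤ μ) :
    regBeta ε (k + 1) μ < regBeta ε k μ := by
  rw [regBeta_eq_add h0.le h1 k μ]
  have h2 : 0 < 1 - ε := by linarith
  have h3 : 0 < Nat.choose (μ + k - 1) k := Nat.choose_pos (by omega)
  have : 0 < (1 - ε) ^ μ * ((Nat.choose (μ + k - 1) k : ℝ) * ε ^ k) := by positivity
  linarith

theorem regBeta_pos {ε : ℝ} (h0 : 0 < ε) (h1 : ε < 1) (k : ℕ) {μ : ℕ} (hμ : 1 ≤ μ) :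
    0 < regBeta ε k μ :=
  (regBeta_nonneg h0.le h1 (k + 1) μ).trans_lt (regBeta_succ_lt h0 h1 k hμ)

/-- No hypothesis on `ε` is needed: for a divergent series every tail has the default sum `0`. -/
theorem tendsto_regBeta (ε : ℝ) (μ : ℕ) :
    Filter.Tendsto (fun k => regBeta ε k μ) Filter.atTop (nhds 0) := by
  have := (tendsto_sum_nat_add fun j : ℕ => (Nat.choose (μ + j - 1) j : ℝ) * ε ^ j).const_mul
    ((1 - ε) ^ μ)
  rw [mul_zero] at this
  refine this.congr fun k => ?_
  unfold regBeta
  simp only [add_comm k]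

/-- Ratios of successive coefficients of the negative binomial series decrease. -/
theorem choose_mul_choose_le {μ : ℕ} (hμ : 1 ≤ μ) (a i : ℕ) :
    Nat.choose (μ + a - 1) a * Nat.choose (μ + (a + 1 + i) - 1) (a + 1 + i) ≤
      Nat.choose (μ + (a + 1) - 1) (a + 1) * Nat.choose (μ + (a + i) - 1) (a + i) := by
  obtain ⟨n, rfl⟩ : ∃ n, μ = n + 1 := ⟨μ - 1, by omega⟩
  have step : ∀ j, Nat.choose (n + 1 + (j + 1) - 1) (j + 1) * (j + 1) =
      Nat.choose (n + 1 + j - 1) j * (n + 1 + j) := fun j => by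
    have := Nat.add_one_mul_choose_eq (n + j) j
    rw [show n + 1 + (j + 1) - 1 = n + j + 1 by omega, show n + 1 + j - 1 = n + j by omega]
    rw [← this]; ring
  have ha := step a
  have hb := step (a + i)
  rw [show a + 1 + i = a + i + 1 by omega]
  set A := Nat.choose (n + 1 + a - 1) a
  set A' := Nat.choose (n + 1 + (a + 1) - 1) (a + 1)
  set B := Nat.choose (n + 1 + (a + i) - 1) (a + i)
  set B' := Nat.choose (n + 1 + (a + i + 1) - 1) (a + i + 1)
  refine Nat.le_of_mul_le_mul_right (c := (a + 1) * (a + i + 1)) ?_ (by positivity)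
  calc A * B' * ((a + 1) * (a + i + 1)) = A * (B' * (a + i + 1)) * (a + 1) := by ring
    _ = A * B * ((n + 1 + (a + i)) * (a + 1)) := by rw [hb]; ring
    _ ≤ A * B * ((n + 1 + a) * (a + i + 1)) := by
        gcongr A * B * ?_
        nlinarith [Nat.zero_le (n * i)]
    _ = A' * B * ((a + 1) * (a + i + 1)) := by
        rw [show A' * B * ((a + 1) * (a + i + 1)) = (A' * (a + 1)) * B * (a + i + 1) by ring, ha]
        ring

/-- The successive ratio is `(μ + j) / (j + 1) = 1 + (μ - 1) / (j + 1)`, strictly decreasing exactly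
when `μ > 1`. The shift `i + 1` keeps the two indices apart. -/
theorem choose_mul_choose_lt {μ : ℕ} (hμ : 2 ≤ μ) (a i : ℕ) :
    Nat.choose (μ + a - 1) a * Nat.choose (μ + (a + 1 + (i + 1)) - 1) (a + 1 + (i + 1)) <
      Nat.choose (μ + (a + 1) - 1) (a + 1) * Nat.choose (μ + (a + (i + 1)) - 1) (a + (i + 1)) := by
  obtain ⟨n, rfl⟩ : ∃ n, μ = n + 2 := ⟨μ - 2, by omega⟩
  have step : ∀ j, Nat.choose (n + 2 + (j + 1) - 1) (j + 1) * (j + 1) =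
      Nat.choose (n + 2 + j - 1) j * (n + 2 + j) := fun j => by
    have := Nat.add_one_mul_choose_eq (n + 1 + j) j
    rw [show n + 2 + (j + 1) - 1 = n + 1 + j + 1 by omega,
      show n + 2 + j - 1 = n + 1 + j by omega]
    rw [← this]; ring
  have ha := step a
  have hb := step (a + (i + 1))
  have hA : 0 < Nat.choose (n + 2 + a - 1) a := Nat.choose_pos (by omega)
  have hB : 0 < Nat.choose (n + 2 + (a + (i + 1)) - 1) (a + (i + 1)) := Nat.choose_pos (by omega)
  rw [show a + 1 + (i + 1) = a + (i + 1) + 1 by omega]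
  set A := Nat.choose (n + 2 + a - 1) a
  set A' := Nat.choose (n + 2 + (a + 1) - 1) (a + 1)
  set B := Nat.choose (n + 2 + (a + (i + 1)) - 1) (a + (i + 1))
  set B' := Nat.choose (n + 2 + (a + (i + 1) + 1) - 1) (a + (i + 1) + 1)
  refine Nat.lt_of_mul_lt_mul_right (a := (a + 1) * (a + (i + 1) + 1)) ?_
  calc A * B' * ((a + 1) * (a + (i + 1) + 1)) = A * (B' * (a + (i + 1) + 1)) * (a + 1) := by ring
    _ = A * B * ((n + 2 + (a + (i + 1))) * (a + 1)) := by rw [hb]; ring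
    _ < A * B * ((n + 2 + a) * (a + (i + 1) + 1)) := by
        gcongr A * B * ?_
        nlinarith [Nat.zero_le (n * i)]
    _ = A' * B * ((a + 1) * (a + (i + 1) + 1)) := by
        rw [show A' * B * ((a + 1) * (a + (i + 1) + 1)) =
          (A' * (a + 1)) * B * (a + (i + 1) + 1) by ring, ha]
        ring

/-- Log-concavity passes from the coefficients to the tails. With `t j` the terms of the series, the
defect equals `(1 - ε) ^ (2 * μ)` times `∑ (t (k + 1) * t (k + 1 + i) - t k * t (k + 2 + i))`, and
each summand is nonnegative; for `μ ≥ 2` the one at `i = 0` is positive. -/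
theorem regBeta_mul_le_sq {ε : ℝ} (h0 : 0 < ε) (h1 : ε < 1) (k : ℕ) {μ : ℕ} (hμ : 1 ≤ μ) :
    regBeta ε k μ * regBeta ε (k + 2) μ ≤ regBeta ε (k + 1) μ ^ 2 ∧
    (2 ≤ μ → regBeta ε k μ * regBeta ε (k + 2) μ < regBeta ε (k + 1) μ ^ 2) := by
  have hc : 0 < (1 - ε) ^ μ := pow_pos (by linarith) _
  have e0 := regBeta_eq_add h0.le h1 k μ
  have e1 := regBeta_eq_add h0.le h1 (k + 1) μ
  set t : ℕ → ℝ := fun j => (Nat.choose (μ + j - 1) j : ℝ) * ε ^ j with ht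
  have s1 : Summable fun i => t (k + 1) * t (k + 1 + i) :=
    (summable_regBeta_tail h0.le h1 (k + 1) μ).mul_left _
  have s2 : Summable fun i => t k * t (k + 2 + i) :=
    (summable_regBeta_tail h0.le h1 (k + 2) μ).mul_left _
  have term : ∀ i, t k * t (k + 2 + i) ≤ t (k + 1) * t (k + 1 + i) := fun i => by
    have := choose_mul_choose_le hμ k (i + 1)
    have h := mul_le_mul_of_nonneg_right (Nat.cast_le (α := ℝ).2 this)
      (pow_nonneg h0.le (k + (k + 2 + i)))
    simp only [ht]
    rw [show k + 1 + (i + 1) = k + 2 + i by omega, show k + (i + 1) = k + 1 + i by omega] at h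
    push_cast at h
    calc _ = _ := by rw [pow_add]; ring
      _ ≤ _ := h
      _ = _ := by rw [show k + (k + 2 + i) = k + 1 + (k + 1 + i) by omega, pow_add]; ring
  have d1 : regBeta ε (k + 1) μ = (1 - ε) ^ μ * ∑' i, t (k + 1 + i) := rfl
  have d2 : regBeta ε (k + 2) μ = (1 - ε) ^ μ * ∑' i, t (k + 2 + i) := rfl
  change regBeta ε k μ = (1 - ε) ^ μ * t k + _ at e0
  change regBeta ε (k + 1) μ = (1 - ε) ^ μ * t (k + 1) + regBeta ε (k + 2) μ at e1
  have key : regBeta ε (k + 1) μ ^ 2 - regBeta ε k μ * regBeta ε (k + 2) μ =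
      ((1 - ε) ^ μ) ^ 2 *
        ((∑' i, t (k + 1) * t (k + 1 + i)) - ∑' i, t k * t (k + 2 + i)) := by
    rw [tsum_mul_left, tsum_mul_left, e0]
    have : regBeta ε (k + 1) μ ^ 2 - ((1 - ε) ^ μ * t k + regBeta ε (k + 1) μ) *
      regBeta ε (k + 2) μ = regBeta ε (k + 1) μ * (regBeta ε (k + 1) μ - regBeta ε (k + 2) μ)
        - (1 - ε) ^ μ * t k * regBeta ε (k + 2) μ := by ring
    rw [this, show regBeta ε (k + 1) μ - regBeta ε (k + 2) μ = (1 - ε) ^ μ * t (k + 1) by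
      linarith, d1, d2]
    ring
  constructor
  · have := s2.tsum_le_tsum term s1
    have : 0 ≤ ((1 - ε) ^ μ) ^ 2 *
      ((∑' i, t (k + 1) * t (k + 1 + i)) - ∑' i, t k * t (k + 2 + i)) :=
      mul_nonneg (by positivity) (by linarith)
    linarith
  · intro hμ2
    have lt0 : t k * t (k + 2 + 0) < t (k + 1) * t (k + 1 + 0) := by
      have := choose_mul_choose_lt hμ2 k 0
      have h := mul_lt_mul_of_pos_right (Nat.cast_lt (α := ℝ).2 this)
        (pow_pos h0 (k + (k + 2 + 0)))
      simp only [ht]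
      rw [show k + 1 + (0 + 1) = k + 2 + 0 by omega, show k + (0 + 1) = k + 1 + 0 by omega] at h
      push_cast at h
      calc _ = _ := by rw [pow_add]; ring
        _ < _ := h
        _ = _ := by rw [show k + (k + 2 + 0) = k + 1 + (k + 1 + 0) by omega, pow_add]; ring
    have := s2.tsum_lt_tsum term lt0 s1
    have : 0 < ((1 - ε) ^ μ) ^ 2 *
      ((∑' i, t (k + 1) * t (k + 1 + i)) - ∑' i, t k * t (k + 2 + i)) :=
      mul_pos (by positivity) (by linarith)
    linarith

/-! ### A convexity inequality -/

/-- Majorization: `x` and `y` lie between `x * y` and `x + y - x * y`, and both pairs have the same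
sum, so the outer pair has the larger sum under a convex function. -/
theorem rpow_add_rpow_le {t x y : ℝ} (ht : 1 ≤ t) (hx0 : 0 ≤ x) (hx1 : x ≤ 1) (hy0 : 0 ≤ y)
    (hy1 : y ≤ 1) : x ^ t + y ^ t ≤ (x + y - x * y) ^ t + (x * y) ^ t := by
  have hc := convexOn_rpow ht
  have hp : 0 ≤ x * y := mul_nonneg hx0 hy0
  have hq : 0 ≤ x + y - x * y := by nlinarith
  rcases eq_or_ne (x + y - 2 * (x * y)) 0 with h | h
  · have hx : x * (1 - y) + y * (1 - x) = 0 := by linarith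
    have a1 : 0 ≤ x * (1 - y) := mul_nonneg hx0 (by linarith)
    have a2 : 0 ≤ y * (1 - x) := mul_nonneg hy0 (by linarith)
    have e1 : x * y = x := by linarith
    have e2 : x * y = y := by linarith
    have e3 : x + y - x * y = y := by linarith
    rw [e3, e1]; linarith
  · have a1 : 0 ≤ x * (1 - y) := mul_nonneg hx0 (by linarith)
    have a2 : 0 ≤ y * (1 - x) := mul_nonneg hy0 (by linarith)
    have hd : 0 < x + y - 2 * (x * y) := lt_of_le_of_ne (by linarith) (Ne.symm h)
    -- `D` is the length of the outer interval. The weights `θ, η` express `x`; equality of the sums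
    -- makes the swapped weights express `y`.
    set D := x + y - 2 * (x * y) with hD
    set θ := x * (1 - y) / D
    set η := y * (1 - x) / D
    have hθ : 0 ≤ θ := div_nonneg a1 hd.le
    have hη : 0 ≤ η := div_nonneg a2 hd.le
    have hsum : θ + η = 1 := by
      rw [← add_div, div_eq_one_iff_eq h]; rw [hD]; ring
    have c1 := hc.2 (Set.mem_Ici.2 hq) (Set.mem_Ici.2 hp) hθ hη hsum
    have c2 := hc.2 (Set.mem_Ici.2 hq) (Set.mem_Ici.2 hp) hη hθ (by linarith)
    have hθD : θ * D = x * (1 - y) := div_mul_cancel₀ _ h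
    have hηD : η * D = y * (1 - x) := div_mul_cancel₀ _ h
    have ex : θ * (x + y - x * y) + η * (x * y) = x := by
      have : θ * (x + y - x * y) + η * (x * y) = θ * D + (θ + η) * (x * y) := by rw [hD]; ring
      rw [this, hθD, hsum]; ring
    have ey : η * (x + y - x * y) + θ * (x * y) = y := by
      have : η * (x + y - x * y) + θ * (x * y) = η * D + (θ + η) * (x * y) := by rw [hD]; ring
      rw [this, hηD, hsum]; ring
    simp only [smul_eq_mul] at c1 c2
    rw [ex] at c1
    rw [ey] at c2
    calc x ^ t + y ^ t ≤ _ := add_le_add c1 c2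
      _ = (θ + η) * (x + y - x * y) ^ t + (θ + η) * (x * y) ^ t := by ring
      _ = _ := by rw [hsum]; ring

/-- This compares weights of `(p, 1)` and `(q, 1)` for `x = 1 / p` and `q = p ^ t`. In the
induction, `y = 1 - (1 - x) ^ n` gives `1 - (1 - x) ^ (n + 1) = x + y - x * y`, the shape of the
convexity inequality. -/
theorem one_sub_one_sub_rpow_pow_le {t x : ℝ} (ht : 1 ≤ t) (hx0 : 0 ≤ x) (hx1 : x ≤ 1) (μ : ℕ) :
    1 - (1 - x ^ t) ^ μ ≤ (1 - (1 - x) ^ μ) ^ t := by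
  induction μ with
  | zero => simp [Real.zero_rpow (by linarith : t ≠ 0)]
  | succ n ih =>
    have hp0 : 0 ≤ (1 - x) ^ n := pow_nonneg (by linarith) _
    have hp1 : (1 - x) ^ n ≤ 1 := pow_le_one₀ (by linarith) (by linarith)
    have hxt : x ^ t ≤ 1 := Real.rpow_le_one hx0 hx1 (by linarith)
    set y := 1 - (1 - x) ^ n with hy
    have key := rpow_add_rpow_le ht hx0 hx1 (show 0 ≤ y by linarith) (show y ≤ 1 by linarith)
    rw [Real.mul_rpow hx0 (by linarith)] at key
    have e : 1 - (1 - x) ^ (n + 1) = x + y - x * y := by rw [hy, pow_succ]; ring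
    rw [e]
    have e2 : 1 - (1 - x ^ t) ^ (n + 1) = x ^ t + (1 - x ^ t) * (1 - (1 - x ^ t) ^ n) := by
      rw [pow_succ]; ring
    rw [e2]
    have := mul_le_mul_of_nonneg_left ih (show 0 ≤ 1 - x ^ t by linarith)
    linarith

/-! ### Items -/

theorem one_div_prime_pos {p : ℕ} (hp : p.Prime) : 0 < 1 / (p : ℝ) := by
  have := hp.pos
  positivity

theorem one_div_prime_lt_one {p : ℕ} (hp : p.Prime) : 1 / (p : ℝ) < 1 := by
  have : (1 : ℝ) < p := by exact_mod_cast hp.one_lt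
  rw [div_lt_one (by linarith)]
  exact this

theorem itemWeight_pos {μ : ℕ} (hμ : 1 ≤ μ) {p r : ℕ} (hp : p.Prime) (hr : 1 ≤ r) :
    0 < itemWeight μ (p, r) := by
  obtain ⟨k, rfl⟩ : ∃ k, r = k + 1 := ⟨r - 1, by omega⟩
  have h0 := one_div_prime_pos hp
  have h1 := one_div_prime_lt_one hp
  simp only [itemWeight, Nat.add_sub_cancel]
  exact sub_pos.2 (Real.logb_lt_logb one_lt_two (regBeta_pos h0 h1 _ hμ)
    (regBeta_succ_lt h0 h1 k hμ))

theorem itemVal_pos {p r : ℕ} (hp : p.Prime) : 0 < itemVal (p, r) :=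
  Real.logb_pos one_lt_two (by exact_mod_cast hp.one_lt)

theorem itemWeight_le_succ {μ : ℕ} (hμ : 1 ≤ μ) {p r : ℕ} (hp : p.Prime) (hr : 1 ≤ r) :
    itemWeight μ (p, r) ≤ itemWeight μ (p, r + 1) ∧
    (2 ≤ μ → itemWeight μ (p, r) < itemWeight μ (p, r + 1)) := by
  obtain ⟨k, rfl⟩ : ∃ k, r = k + 1 := ⟨r - 1, by omega⟩
  have h0 := one_div_prime_pos hp
  have h1 := one_div_prime_lt_one hp
  have hk := regBeta_mul_le_sq h0 h1 k hμ
  have p0 := regBeta_pos h0 h1 k hμ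
  have p1 := regBeta_pos h0 h1 (k + 1) hμ
  have p2 := regBeta_pos h0 h1 (k + 2) hμ
  simp only [itemWeight, Nat.add_sub_cancel]
  constructor
  · have := Real.logb_le_logb_of_le one_lt_two (mul_pos p0 p2) hk.1
    rw [Real.logb_mul p0.ne' p2.ne', Real.logb_pow] at this
    push_cast at this
    linarith
  · intro h2
    have := Real.logb_lt_logb one_lt_two (mul_pos p0 p2) (hk.2 h2)
    rw [Real.logb_mul p0.ne' p2.ne', Real.logb_pow] at this
    push_cast at this
    linarith

theorem itemDensity_antitoneOn {μ : ℕ} (hμ : 1 ≤ μ) {p : ℕ} (hp : p.Prime) :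
    AntitoneOn (fun r => itemDensity μ (p, r)) (Set.Ici 1) := by
  intro a ha b _ hab
  induction b, hab using Nat.le_induction with
  | base => exact le_rfl
  | succ n hn ih =>
    have hn1 : 1 ≤ n := le_trans ha hn
    refine le_trans ?_ (ih hn1)
    exact div_le_div_of_nonneg_left (itemVal_pos hp (r := n)).le (itemWeight_pos hμ hp hn1)
      (itemWeight_le_succ hμ hp hn1).1

theorem itemDensity_strictAntiOn {μ : ℕ} (hμ : 2 ≤ μ) {p : ℕ} (hp : p.Prime) :
    StrictAntiOn (fun r => itemDensity μ (p, r)) (Set.Ici 1) := by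
  intro a ha b hb hab
  have ha : 1 ≤ a := ha
  refine lt_of_le_of_lt (itemDensity_antitoneOn (by omega) hp (Set.mem_Ici.2 (by omega)) hb
    (Nat.succ_le_of_lt hab)) ?_
  exact div_lt_div_of_pos_left (itemVal_pos hp (r := a)) (itemWeight_pos (by omega) hp ha)
    ((itemWeight_le_succ (by omega) hp ha).2 hμ)

theorem itemWeight_one (μ : ℕ) {p : ℕ} (hp : p.Prime) :
    itemWeight μ (p, 1) = - Real.logb 2 (1 - (1 - 1 / (p : ℝ)) ^ μ) := by
  have h0 := one_div_prime_pos hp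
  have h1 := one_div_prime_lt_one hp
  simp only [itemWeight, Nat.sub_self, regBeta_zero h0.le h1, regBeta_one h0.le h1,
    Real.logb_one, zero_sub]

theorem itemDensity_one_antitoneOn {μ : ℕ} (hμ : 1 ≤ μ) :
    AntitoneOn (fun p => itemDensity μ (p, 1)) {p : ℕ | p.Prime} := by
  intro p hp q hq hpq
  have hp : p.Prime := hp
  have hq : q.Prime := hq
  have hx0 := one_div_prime_pos hp
  have hx1 := one_div_prime_lt_one hp
  have vp := itemVal_pos hp (r := 1)
  have vq := itemVal_pos hq (r := 1)
  change itemVal (q, 1) / itemWeight μ (q, 1) ≤ itemVal (p, 1) / itemWeight μ (p, 1)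
  rw [div_le_div_iff₀ (itemWeight_pos hμ hq le_rfl) (itemWeight_pos hμ hp le_rfl)]
  -- Chosen so that `q = p ^ t`; the claim becomes `t * weight(p, 1) ≤ weight(q, 1)`.
  set t := itemVal (q, 1) / itemVal (p, 1) with ht
  have hpos : 0 < 1 - (1 - 1 / (p : ℝ)) ^ μ := by
    rw [← regBeta_one hx0.le hx1]; exact regBeta_pos hx0 hx1 _ hμ
  have hposq : 0 < 1 - (1 - 1 / (q : ℝ)) ^ μ := by
    rw [← regBeta_one (one_div_prime_pos hq).le (one_div_prime_lt_one hq)]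
    exact regBeta_pos (one_div_prime_pos hq) (one_div_prime_lt_one hq) _ hμ
  have ht1 : 1 ≤ t := by
    rw [ht, one_le_div vp]
    exact Real.logb_le_logb_of_le one_lt_two (by exact_mod_cast hp.pos) (by exact_mod_cast hpq)
  have hxt : (1 / (p : ℝ)) ^ t = 1 / (q : ℝ) := by
    have p0 : (0 : ℝ) < p := by exact_mod_cast hp.pos
    have q0 : (0 : ℝ) < q := by exact_mod_cast hq.pos
    rw [one_div, one_div, Real.inv_rpow p0.le]
    congr 1
    have e : (p : ℝ) = 2 ^ itemVal (p, 1) := (Real.rpow_logb two_pos (by norm_num) p0).symm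
    rw [e, ← Real.rpow_mul two_pos.le, ht, mul_div_cancel₀ _ vp.ne']
    exact Real.rpow_logb two_pos (by norm_num) q0
  have key := one_sub_one_sub_rpow_pow_le ht1 hx0.le hx1.le μ
  rw [hxt] at key
  have := Real.logb_le_logb_of_le one_lt_two hposq key
  rw [Real.logb_rpow_eq_mul_logb_of_pos hpos] at this
  rw [itemWeight_one μ hp, itemWeight_one μ hq]
  have h2 := mul_le_mul_of_nonneg_left this vp.le
  rw [← mul_assoc, ht, mul_div_cancel₀ _ vp.ne'] at h2
  linarith

/-! ### The enumeration scheme -/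

/-- The invariant of the enumeration scheme. -/
structure EnumInv {A B : Type*} [LinearOrder A] [OrderBot A] [LinearOrder B] [OrderBot B]
    (f : A × B → ℝ) (L : List (A × B)) (s : EnumState A B) : Prop where
  finite : s.C.Finite
  row_unique : ∀ a b c, (a, b) ∈ s.C → (a, c) ∈ s.C → b = c
  lt_of_mem : ∀ a b c, (a, b) ∈ L → (a, c) ∈ s.C → b < c
  row_le : ∀ x ∈ s.C, x.1 ≤ s.maxA
  list_row_le : ∀ x ∈ L, x.1 ≤ s.maxA
  eq_of_bot : ∀ a, (a, ⊥) ∈ s.C → a = s.maxA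
  bot_of_max : ∀ b, (s.maxA, b) ∈ s.C → ¬ IsMax s.maxA → b = ⊥
  cover : ∀ a b, (a, b) ∉ L → ∃ x ∈ s.C, (x.1 = a ∧ x.2 ≤ b) ∨ (x.2 = ⊥ ∧ x.1 ≤ a)
  nodup : L.Nodup
  sorted : L.Pairwise fun x y => f y ≤ f x
  dominates : ∀ x ∈ L, ∀ y, y ∉ L → f y ≤ f x

/-- Here `cover` pays off: an unlisted pair is reached either along its own row, or from the bottom
of an earlier row by going across and then up. Neither path needs to be finite, so limit elements of
`A` and `B` do no harm. -/
theorem EnumInv.exists_ge {A B : Type*} [LinearOrder A] [OrderBot A] [LinearOrder B] [OrderBot B]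
    {f : A × B → ℝ} (hA : Antitone fun a => f (a, ⊥)) (hB : ∀ a, Antitone fun b => f (a, b))
    {L : List (A × B)} {s : EnumState A B} (h : EnumInv f L s) {y : A × B} (hy : y ∉ L) :
    ∃ x ∈ s.C, f y ≤ f x := by
  obtain ⟨a, b⟩ := y
  obtain ⟨⟨c, d⟩, hx, h | h⟩ := h.cover a b hy
  · obtain ⟨rfl, hd⟩ := h
    exact ⟨_, hx, hB _ hd⟩
  · obtain ⟨rfl, hc⟩ := h
    exact ⟨_, hx, (hB a bot_le).trans (hA hc)⟩

theorem EnumRun.inv {A B : Type*} [LinearOrder A] [OrderBot A] [SuccOrder A]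
    [LinearOrder B] [OrderBot B] [SuccOrder B] {f : A × B → ℝ}
    (hA : Antitone fun a => f (a, ⊥)) (hB : ∀ a, Antitone fun b => f (a, b))
    {L : List (A × B)} {s : EnumState A B} (h : EnumRun f L s) : EnumInv f L s := by
  induction h with
  | init =>
    constructor <;> simp
    rintro a b c - rfl - rfl
    rfl
  | @step L s x _ hx hmax ih =>
    obtain ⟨p, q⟩ := x
    have hxL : (p, q) ∉ L := fun h => (ih.lt_of_mem p q q h hx).false
    have hge : ∀ y, y ∉ L → f y ≤ f (p, q) := fun y hy =>
      let ⟨z, hz, hle⟩ := ih.exists_ge hA hB hy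
      hle.trans (hmax z hz)
    have hmem : ∀ a b, (a, b) ∈ (enumNext s (p, q)).C ↔
        ((a, b) ∈ s.C ∧ ¬ (a = p ∧ b = q)) ∨ (¬ IsMax q ∧ a = p ∧ b = Order.succ q) ∨
          (p = s.maxA ∧ ¬ IsMax p ∧ a = Order.succ p ∧ b = ⊥) := fun a b => by
      simp [enumNext, or_assoc]
    have hp := ih.row_le _ hx
    have hM : (enumNext s (p, q)).maxA = if p = s.maxA then Order.succ p else s.maxA := rfl
    have hMle : s.maxA ≤ (enumNext s (p, q)).maxA := by
      rw [hM]
      split_ifs with h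
      · rw [← h]; exact Order.le_succ p
      · exact le_rfl
    have hnewrow : p = s.maxA → ¬ IsMax p → s.maxA < Order.succ p := fun h h' => by
      rw [← h]; exact Order.lt_succ_of_not_isMax h'
    constructor
    · refine ((ih.finite.subset Set.sdiff_subset).union ?_).union ?_
      · exact (Set.finite_singleton (p, Order.succ q)).subset fun y hy => hy.2
      · exact (Set.finite_singleton (Order.succ p, (⊥ : B))).subset fun y hy => hy.2.2
    · intro a b c hb hc
      rw [hmem] at hb hc
      -- Each candidate is old, the successor in the popped row, or the bottom of a new row; the
      -- nine combinations follow.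
      rcases hb with ⟨hb, nb⟩ | ⟨-, hb1, hb2⟩ | ⟨hb0, hb1, hb2, hb3⟩ <;>
        rcases hc with ⟨hc, nc⟩ | ⟨-, hc1, hc2⟩ | ⟨hc0, hc1, hc2, hc3⟩
      · exact ih.row_unique a b c hb hc
      · subst hc1
        exact absurd ⟨rfl, ih.row_unique _ _ _ hb hx⟩ nb
      · have := ih.row_le _ hb
        rw [hc2] at this
        exact absurd this (hnewrow hc0 hc1).not_ge
      · subst hb1
        exact absurd ⟨rfl, ih.row_unique _ _ _ hc hx⟩ nc
      · rw [hb2, hc2]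
      · rw [hb1] at hc2
        exact absurd hc2 (Order.lt_succ_of_not_isMax hc1).ne
      · have := ih.row_le _ hc
        rw [hb2] at this
        exact absurd this (hnewrow hb0 hb1).not_ge
      · rw [hc1] at hb2
        exact absurd hb2 (Order.lt_succ_of_not_isMax hb1).ne
      · rw [hb3, hc3]
    · intro a b c hb hc
      rw [hmem] at hc
      rw [List.mem_append, List.mem_singleton, Prod.mk.injEq] at hb
      rcases hb with hb | ⟨hb1, hb2⟩ <;>
        rcases hc with ⟨hc, nc⟩ | ⟨hcm, hc1, hc2⟩ | ⟨hc0, hc1, hc2, hc3⟩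
      · exact ih.lt_of_mem a b c hb hc
      · subst hc1
        rw [hc2]
        exact (ih.lt_of_mem _ _ _ hb hx).trans_le (Order.le_succ q)
      · have := ih.list_row_le _ hb
        rw [hc2] at this
        exact absurd this (hnewrow hc0 hc1).not_ge
      · subst hb1
        exact absurd ⟨rfl, ih.row_unique _ _ _ hc hx⟩ nc
      · rw [hb2, hc2]
        exact Order.lt_succ_of_not_isMax hcm
      · rw [hb1] at hc2
        exact absurd hc2 (Order.lt_succ_of_not_isMax hc1).ne
    · rintro ⟨a, b⟩ hy
      rw [hmem] at hy
      rcases hy with ⟨hy, -⟩ | ⟨-, rfl, -⟩ | ⟨h0, -, rfl, -⟩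
      · exact (ih.row_le _ hy).trans hMle
      · exact hp.trans hMle
      · rw [hM, if_pos h0]
    · intro y hy
      rw [List.mem_append, List.mem_singleton] at hy
      rcases hy with hy | rfl
      · exact (ih.list_row_le _ hy).trans hMle
      · exact hp.trans hMle
    · intro a ha
      rw [hmem] at ha
      rw [hM]
      rcases ha with ⟨ha, na⟩ | ⟨hq, -, ha⟩ | ⟨h0, -, rfl, -⟩
      · have haM := ih.eq_of_bot a ha
        split_ifs with h
        -- Either the top row is maximal, so `Order.succ` fixes it, or its only candidate was its
        -- bottom, which has just been removed.
        · by_cases hmx : IsMax p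
          · rw [haM, ← h]; exact hmx.succ_eq.symm
          · have : q = ⊥ := ih.bot_of_max q (h ▸ hx) (h ▸ hmx)
            exact absurd ⟨haM.trans h.symm, this.symm⟩ na
        · exact haM
      · have := Order.lt_succ_of_not_isMax hq
        rw [← ha] at this
        exact absurd this not_lt_bot
      · rw [if_pos h0]
    · intro b hb hmx
      rw [hmem] at hb
      rw [hM] at hb hmx
      by_cases h : p = s.maxA
      · rw [if_pos h] at hb hmx
        have hpm : ¬ IsMax p := fun h' => hmx (h'.succ_eq.symm ▸ h')
        have hlt := Order.lt_succ_of_not_isMax hpm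
        rcases hb with ⟨hb, -⟩ | ⟨-, hb, -⟩ | ⟨-, -, -, hb⟩
        · have := ih.row_le _ hb
          rw [← h] at this
          exact absurd this hlt.not_ge
        · exact absurd hb hlt.ne'
        · exact hb
      · rw [if_neg h] at hb hmx
        rcases hb with ⟨hb, -⟩ | ⟨-, hb, -⟩ | ⟨h', -⟩
        · exact ih.bot_of_max b hb hmx
        · exact absurd hb.symm h
        · exact absurd h' h
    · intro a b hab
      rw [List.mem_append, List.mem_singleton, Prod.mk.injEq, not_or] at hab
      obtain ⟨habL, habx⟩ := hab
      have row : p = a → q ≤ b →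
          ∃ x ∈ (enumNext s (p, q)).C, (x.1 = a ∧ x.2 ≤ b) ∨ (x.2 = ⊥ ∧ x.1 ≤ a) := by
        rintro rfl hqb
        have hlt : q < b := lt_of_le_of_ne hqb fun h => habx ⟨rfl, h.symm⟩
        exact ⟨(p, Order.succ q), (hmem _ _).2 (.inr (.inl ⟨hlt.not_isMax, rfl, rfl⟩)),
          .inl ⟨rfl, Order.succ_le_of_lt hlt⟩⟩
      obtain ⟨⟨c, d⟩, hc, hcd⟩ := ih.cover a b habL
      by_cases hcx : c = p ∧ d = q
      · obtain ⟨rfl, rfl⟩ := hcx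
        rcases hcd with ⟨h1, h2⟩ | ⟨h1, h2⟩
        · exact row h1 h2
        -- The popped pair covered later rows as a bottom element. By `eq_of_bot` its row was
        -- `maxA`, so the bottom of the next row has just been added and takes over.
        · rcases eq_or_lt_of_le h2 with h2 | h2
          · exact row h2 (h1.le.trans bot_le)
          · have h1 : d = ⊥ := h1
            subst h1
            exact ⟨(Order.succ c, ⊥), (hmem _ _).2 (.inr (.inr
              ⟨ih.eq_of_bot c hx, h2.not_isMax, rfl, rfl⟩)), .inr ⟨rfl, Order.succ_le_of_lt h2⟩⟩
      · exact ⟨(c, d), (hmem _ _).2 (.inl ⟨hc, hcx⟩), hcd⟩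
    · rw [List.nodup_append]
      refine ⟨ih.nodup, List.nodup_singleton _, fun a ha b hb hab => ?_⟩
      rw [List.mem_singleton] at hb
      exact hxL (hb ▸ hab ▸ ha)
    · rw [List.pairwise_append]
      refine ⟨ih.sorted, List.pairwise_singleton _ _, fun a ha b hb => ?_⟩
      rw [List.mem_singleton] at hb
      exact ih.dominates a ha b (hb ▸ hxL)
    · intro y hy z hz
      rw [List.mem_append, not_or] at hz
      rw [List.mem_append, List.mem_singleton] at hy
      rcases hy with hy | rfl
      · exact ih.dominates y hy z hz.1
      · exact hge z hz.1

theorem EnumInv.exists_max {A B : Type*} [LinearOrder A] [OrderBot A] [LinearOrder B] [OrderBot B]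
    {f : A × B → ℝ} {L : List (A × B)} {s : EnumState A B} (h : EnumInv f L s)
    (hy : ∃ y, y ∉ L) : ∃ x ∈ s.C, ∀ y ∈ s.C, f y ≤ f x := by
  obtain ⟨⟨a, b⟩, hy⟩ := hy
  obtain ⟨x, hx, -⟩ := h.cover a b hy
  exact s.C.exists_max_image f h.finite ⟨x, hx⟩

/-! ### The greedy algorithm as an instance of the enumeration scheme -/

theorem nextPrime_nth (a : ℕ) :
    nextPrime (Nat.nth Nat.Prime a) = Nat.nth Nat.Prime (a + 1) := by
  have hmono := Nat.nth_strictMono Nat.infinite_setOfPred_prime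
  have hmem : Nat.nth Nat.Prime (a + 1) ∈ {q : ℕ | q.Prime ∧ Nat.nth Nat.Prime a < q} :=
    ⟨Nat.prime_nth_prime _, hmono (Nat.lt_succ_self a)⟩
  refine le_antisymm (Nat.sInf_le hmem) (le_csInf ⟨_, hmem⟩ ?_)
  rintro q ⟨hq, hlt⟩
  rw [← Nat.nth_count hq] at hlt ⊢
  exact hmono.monotone (Nat.succ_le_of_lt (hmono.lt_iff_lt.1 hlt))

/-- The item given by the index of a prime and a multiplicity counted from `0`. -/
noncomputable def itemOfIndex (z : ℕ × ℕ) : ℕ × ℕ := (Nat.nth Nat.Prime z.1, z.2 + 1)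

theorem itemOfIndex_injective : Function.Injective itemOfIndex := by
  rintro ⟨a, b⟩ ⟨c, d⟩ h
  simp only [itemOfIndex, Prod.mk.injEq, Nat.add_right_cancel_iff] at h
  rw [(Nat.nth_strictMono Nat.infinite_setOfPred_prime).injective h.1, h.2]

theorem itemOfIndex_count {p r : ℕ} (hp : p.Prime) (hr : 1 ≤ r) :
    itemOfIndex (Nat.count Nat.Prime p, r - 1) = (p, r) := by
  simp only [itemOfIndex, Nat.nth_count hp, Nat.sub_add_cancel hr]

/-- A step-by-step simulation: heap and candidate set correspond under `itemOfIndex`, so any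
tie-breaking choice transfers. As ℕ has no maximum, every insertion of the scheme takes place. -/
theorem GreedyRun.exists_enumRun {lam μ : ℕ} {L : List (ℕ × ℕ)} {s : GreedyState}
    (h : GreedyRun lam μ L s) :
    ∃ L' t, EnumRun (fun z => itemDensity μ (itemOfIndex z)) L' t ∧ L = L'.map itemOfIndex ∧
      (∀ y, y ∈ s.heap ↔ ∃ z ∈ t.C, itemOfIndex z = y) ∧ s.pmax = Nat.nth Nat.Prime t.maxA := by
  induction h with
  | init =>
    refine ⟨[], _, .init, rfl, fun y => ?_, ?_⟩
    · simp [greedyInit, itemOfIndex, eq_comm]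
    · simp [greedyInit]
  | @step L s x _ _ hx ih =>
    obtain ⟨L', t, hrun, hL, hheap, hpmax⟩ := ih
    obtain ⟨z, hz, rfl⟩ := (hheap x).1 hx.1
    have hmax : ∀ y ∈ t.C, itemDensity μ (itemOfIndex y) ≤ itemDensity μ (itemOfIndex z) :=
      fun y hy => hx.2 _ ((hheap _).2 ⟨y, hy, rfl⟩)
    have hiff : (itemOfIndex z).1 = s.pmax ↔ z.1 = t.maxA := by
      rw [hpmax]
      exact (Nat.nth_strictMono Nat.infinite_setOfPred_prime).injective.eq_iff
    have hnext : nextPrime (itemOfIndex z).1 = Nat.nth Nat.Prime (z.1 + 1) := nextPrime_nth z.1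
    refine ⟨L' ++ [z], _, hrun.step hz hmax, by simp [hL], fun y => ?_, ?_⟩
    · have e1 : y ∈ (greedyNext μ s (itemOfIndex z)).heap ↔
          (y ≠ itemOfIndex z ∧ y ∈ s.heap) ∨ y = itemOfIndex (z.1, z.2 + 1) ∨
            (z.1 = t.maxA ∧ y = itemOfIndex (z.1 + 1, 0)) := by
        simp only [greedyNext, hiff, hnext]
        split_ifs with h
        · simp only [Finset.mem_insert, Finset.mem_erase, h, true_and, itemOfIndex, zero_add]
          tauto
        · simp only [Finset.mem_insert, Finset.mem_erase, h, false_and, or_false, itemOfIndex]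
          tauto
      rw [e1, hheap]
      have e2 : ∀ z', z' ∈ (enumNext t z).C ↔ (z' ∈ t.C ∧ z' ≠ z) ∨ z' = (z.1, z.2 + 1) ∨
          (z.1 = t.maxA ∧ z' = (z.1 + 1, 0)) := fun z' => by
        simp only [enumNext, Set.mem_union, Set.mem_sdiff, Set.mem_singleton_iff, Set.mem_ofPred_eq,
          not_isMax, not_false_eq_true, true_and, or_assoc]
        rfl
      simp only [e2]
      constructor
      · rintro (⟨hne, z', hz', rfl⟩ | rfl | ⟨h, rfl⟩)
        · exact ⟨z', .inl ⟨hz', fun h => hne (h ▸ rfl)⟩, rfl⟩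
        · exact ⟨_, .inr (.inl rfl), rfl⟩
        · exact ⟨_, .inr (.inr ⟨h, rfl⟩), rfl⟩
      · rintro ⟨z', ⟨hz', hne⟩ | rfl | ⟨h, rfl⟩, rfl⟩
        · exact .inl ⟨fun h => hne (itemOfIndex_injective h), z', hz', rfl⟩
        · exact .inr (.inl rfl)
        · exact .inr (.inr ⟨h, rfl⟩)
    · simp only [greedyNext, enumNext, hiff, hnext]
      split_ifs
      · rfl
      · exact hpmax

theorem GreedyRun.exists_enumInv {lam μ : ℕ} (hμ : 1 ≤ μ) {L : List (ℕ × ℕ)} {s : GreedyState}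
    (h : GreedyRun lam μ L s) :
    ∃ L' t, EnumInv (fun z => itemDensity μ (itemOfIndex z)) L' t ∧ L = L'.map itemOfIndex ∧
      ∀ y, y ∈ s.heap ↔ ∃ z ∈ t.C, itemOfIndex z = y := by
  obtain ⟨L', t, hrun, hL, hheap, -⟩ := h.exists_enumRun
  refine ⟨L', t, hrun.inv (fun a b hab => ?_) (fun a b c hbc => ?_), hL, hheap⟩
  · exact itemDensity_one_antitoneOn hμ (Nat.prime_nth_prime a) (Nat.prime_nth_prime b)
      ((Nat.nth_strictMono Nat.infinite_setOfPred_prime).monotone hab)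
  · exact itemDensity_antitoneOn hμ (Nat.prime_nth_prime a) (Set.mem_Ici.2 (Nat.le_add_left 1 b))
      (Set.mem_Ici.2 (Nat.le_add_left 1 c)) (Nat.add_le_add_right hbc 1)

theorem GreedyRun.sorted {lam μ : ℕ} (hμ : 1 ≤ μ) {L : List (ℕ × ℕ)} {s : GreedyState}
    (h : GreedyRun lam μ L s) :
    L.Nodup ∧ (∀ x ∈ L, x.1.Prime ∧ 1 ≤ x.2) ∧
      L.Pairwise (fun x y => itemDensity μ y ≤ itemDensity μ x) ∧
      ∀ x ∈ L, ∀ p r : ℕ, p.Prime → 1 ≤ r → (p, r) ∉ L →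
        itemDensity μ (p, r) ≤ itemDensity μ x := by
  obtain ⟨L', t, hinv, rfl, -⟩ := h.exists_enumInv hμ
  refine ⟨hinv.nodup.map itemOfIndex_injective, ?_, List.pairwise_map.2 hinv.sorted, ?_⟩
  · intro x hx
    obtain ⟨z, -, rfl⟩ := List.mem_map.1 hx
    exact ⟨Nat.prime_nth_prime _, Nat.le_add_left 1 _⟩
  · intro x hx p r hp hr hpr
    obtain ⟨z, hz, rfl⟩ := List.mem_map.1 hx
    rw [← itemOfIndex_count hp hr] at hpr ⊢
    exact hinv.dominates z hz _ fun h => hpr (List.mem_map_of_mem h)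

theorem GreedyRun.exists_isHeapMax {lam μ : ℕ} (hμ : 1 ≤ μ) {L : List (ℕ × ℕ)} {s : GreedyState}
    (h : GreedyRun lam μ L s) : ∃ x, IsHeapMax μ s x := by
  obtain ⟨L', t, hinv, -, hheap⟩ := h.exists_enumInv hμ
  obtain ⟨z, hz, hmax⟩ := hinv.exists_max (Infinite.exists_notMem_finset L'.toFinset |>.imp
    fun y hy => by simpa using hy)
  refine ⟨itemOfIndex z, (hheap _).2 ⟨z, hz, rfl⟩, fun y hy => ?_⟩
  obtain ⟨z', hz', rfl⟩ := (hheap y).1 hy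
  exact hmax z' hz'

theorem GreedyRun.mem_of_lt {lam μ : ℕ} {L : List (ℕ × ℕ)} {s : GreedyState}
    (h : GreedyRun lam μ L s) :
    ∀ p r r', (p, r) ∈ L ∨ (p, r) ∈ s.heap → 1 ≤ r' → r' < r → (p, r') ∈ L := by
  induction h with
  | init =>
    intro p r r' hpr h1 h2
    simp [greedyInit] at hpr
    omega
  | @step L s x _ _ hx ih =>
    intro p r r' hpr h1 h2
    have hcases : ((p, r) ∈ L ∨ (p, r) ∈ s.heap) ∨ (p = x.1 ∧ r = x.2 + 1) ∨ r = 1 := by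
      simp only [greedyNext, List.mem_append, List.mem_singleton] at hpr
      rcases hpr with (hpr | rfl) | hpr
      · exact .inl (.inl hpr)
      · exact .inl (.inr hx.1)
      · split_ifs at hpr <;>
          simp only [Finset.mem_insert, Finset.mem_erase, Prod.mk.injEq] at hpr <;> tauto
    rw [List.mem_append, List.mem_singleton]
    rcases hcases with hc | ⟨rfl, rfl⟩ | rfl
    · exact .inl (ih p r r' hc h1 h2)
    · rcases eq_or_lt_of_le (Nat.lt_succ_iff.1 h2) with rfl | h3
      · exact .inr rfl
      · exact .inl (ih x.1 x.2 r' (.inr hx.1) h1 h3)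
    · omega

theorem GreedyRun.v_eq {lam μ : ℕ} {L : List (ℕ × ℕ)} {s : GreedyState}
    (h : GreedyRun lam μ L s) : s.v = (L.map itemVal).sum := by
  induction h with
  | init => rfl
  | step _ _ _ ih => simp [greedyNext, ih]

theorem GreedyRun.w_eq {lam μ : ℕ} {L : List (ℕ × ℕ)} {s : GreedyState}
    (h : GreedyRun lam μ L s) : s.w = (L.map (itemWeight μ)).sum := by
  induction h with
  | init => rfl
  | step _ _ _ ih => simp [greedyNext, ih]

/-! ### Termination -/

theorem sum_itemWeight {μ : ℕ} {p : ℕ} (hp : p.Prime) (r : ℕ) :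
    ∑ i ∈ Finset.Icc 1 r, itemWeight μ (p, i) = - Real.logb 2 (regBeta (1 / (p : ℝ)) r μ) := by
  induction r with
  | zero => simp [regBeta_zero (one_div_prime_pos hp).le (one_div_prime_lt_one hp), -one_div]
  | succ n ih =>
    rw [Finset.sum_Icc_succ_top (by omega), ih]
    simp only [itemWeight, Nat.add_sub_cancel]
    ring

/-- Bernoulli gives `I ≤ μ / p` for `r ≥ 1`, which bounds `p`; for each `p` the tails tend to `0`,
which bounds `r`. -/
theorem finite_setOf_lt_regBeta {μ : ℕ} {c : ℝ} (hc : 0 < c) :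
    {x : ℕ × ℕ | x.1.Prime ∧ 1 ≤ x.2 ∧ c < regBeta (1 / (x.1 : ℝ)) x.2 μ}.Finite := by
  have hR : ∀ p : ℕ, ∃ R, ∀ r, R ≤ r → regBeta (1 / (p : ℝ)) r μ < c := fun p =>
    Filter.eventually_atTop.1 ((tendsto_regBeta (1 / (p : ℝ)) μ).eventually_lt_const hc)
  choose R hR using hR
  obtain ⟨P, hP⟩ := exists_nat_ge (μ / c)
  refine ((Finset.range P).biUnion fun p =>
    (Finset.range (R p)).image fun r => (p, r)).finite_toSet.subset ?_
  rintro ⟨p, r⟩ ⟨hp, hr, hlt⟩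
  simp only [Finset.coe_biUnion, Finset.coe_range, Finset.coe_image, Set.mem_iUnion]
  have h0 := one_div_prime_pos hp
  have h1 := one_div_prime_lt_one hp
  have hp0 : (0 : ℝ) < p := by exact_mod_cast hp.pos
  refine ⟨p, ?_, r, ?_, rfl⟩
  · have anti : regBeta (1 / (p : ℝ)) r μ ≤ regBeta (1 / (p : ℝ)) 1 μ :=
      antitone_nat_of_succ_le (f := fun k => regBeta (1 / (p : ℝ)) k μ)
        (fun k => regBeta_succ_le h0.le h1 k μ) hr
    rw [regBeta_one h0.le h1] at anti
    have bern := one_add_mul_le_pow (show (-2 : ℝ) ≤ -(1 / (p : ℝ)) by linarith) μ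
    have : c < μ * (1 / (p : ℝ)) := by
      rw [← sub_eq_add_neg] at bern
      have hlt : c < regBeta (1 / (p : ℝ)) r μ := hlt
      linarith
    rw [mul_one_div, lt_div_iff₀ hp0] at this
    have : (p : ℝ) < μ / c := by rw [lt_div_iff₀ hc]; linarith
    exact Set.mem_Iio.2 (by exact_mod_cast this.trans_le hP)
  · by_contra h
    exact absurd hlt (hR p r (not_lt.1 h)).le.not_gt

theorem GreedyRun.w_eq_sum {lam μ : ℕ} (hμ : 1 ≤ μ) {L : List (ℕ × ℕ)} {s : GreedyState}
    (h : GreedyRun lam μ L s) : s.w = ∑ x ∈ L.toFinset, itemWeight μ x := by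
  rw [h.w_eq, List.sum_toFinset _ (h.sorted hμ).1]

theorem GreedyRun.v_eq_sum {lam μ : ℕ} (hμ : 1 ≤ μ) {L : List (ℕ × ℕ)} {s : GreedyState}
    (h : GreedyRun lam μ L s) : s.v = ∑ x ∈ L.toFinset, itemVal x := by
  rw [h.v_eq, List.sum_toFinset _ (h.sorted hμ).1]

/-- The popped items include `(p, 1), …, (p, r)`, whose weights telescope to `-log₂ I` and total at
most `w < λ`. -/
theorem GreedyRun.lt_regBeta {lam μ : ℕ} (hμ : 1 ≤ μ) {L : List (ℕ × ℕ)} {s : GreedyState}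
    (h : GreedyRun lam μ L s) (hw : s.w < lam) {p r : ℕ} (hpr : (p, r) ∈ L) :
    (2 : ℝ) ^ (-(lam : ℝ)) < regBeta (1 / (p : ℝ)) r μ := by
  obtain ⟨-, hvalid, -⟩ := h.sorted hμ
  have hp := (hvalid _ hpr).1
  rw [← Real.lt_logb_iff_rpow_lt one_lt_two
    (regBeta_pos (one_div_prime_pos hp) (one_div_prime_lt_one hp) r hμ)]
  have hsub : (Finset.Icc 1 r).image (fun i => (p, i)) ⊆ L.toFinset := by
    intro y hy
    obtain ⟨i, hi, rfl⟩ := Finset.mem_image.1 hy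
    rw [Finset.mem_Icc] at hi
    rw [List.mem_toFinset]
    rcases eq_or_lt_of_le hi.2 with rfl | hlt
    · exact hpr
    · exact h.mem_of_lt p r i (.inl hpr) hi.1 hlt
  have := Finset.sum_le_sum_of_subset_of_nonneg hsub (f := itemWeight μ) fun x hx _ =>
    (itemWeight_pos hμ (hvalid x (List.mem_toFinset.1 hx)).1
      (hvalid x (List.mem_toFinset.1 hx)).2).le
  rw [← h.w_eq_sum hμ, Finset.sum_image (fun a _ b _ hab => (Prod.mk.inj hab).2),
    sum_itemWeight hp] at this
  linarith

theorem exists_greedyRun_length_le (lam : ℕ) {μ : ℕ} (hμ : 1 ≤ μ) :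
    ∃ n : ℕ, ∀ L s, GreedyRun lam μ L s → L.length ≤ n := by
  have hfin := finite_setOf_lt_regBeta (μ := μ) (Real.rpow_pos_of_pos two_pos (-(lam : ℝ)))
  -- The extra `1` is the last pop: the loop test only controls the list before it.
  refine ⟨hfin.toFinset.card + 1, fun L s h => ?_⟩
  cases h with
  | init => simp
  | @step L s x hL hw _ =>
    rw [List.length_append, List.length_singleton, Nat.add_le_add_iff_right,
      ← List.toFinset_card_of_nodup (hL.sorted hμ).1]
    refine Finset.card_le_card fun y hy => ?_
    rw [List.mem_toFinset] at hy
    rw [Set.Finite.mem_toFinset]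
    obtain ⟨h1, h2⟩ := (hL.sorted hμ).2.1 y hy
    exact ⟨h1, h2, hL.lt_regBeta hμ hw hy⟩

theorem exists_isGreedyOutput (lam : ℕ) {μ : ℕ} (hμ : 1 ≤ μ) : ∃ k, IsGreedyOutput lam μ k := by
  obtain ⟨n, hn⟩ := exists_greedyRun_length_le lam hμ
  by_contra hno
  have hgrow : ∀ j : ℕ, ∃ L s, GreedyRun lam μ L s ∧ L.length = j := fun j => by
    induction j with
    | zero => exact ⟨_, _, .init, rfl⟩
    | succ j ih =>
      obtain ⟨L, s, hL, hlen⟩ := ih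
      have hw : s.w < lam := not_le.1 fun hw => hno ⟨s.v, L, s, hL, hw, rfl⟩
      obtain ⟨x, hx⟩ := hL.exists_isHeapMax hμ
      exact ⟨_, _, hL.step hw hx, by simp [hlen]⟩
  obtain ⟨L, s, hL, hlen⟩ := hgrow (n + 1)
  have := hn L s hL
  omega

/-! ### The knapsack bound -/

theorem sum_itemVal_sub_le {μ : ℕ} (hμ : 1 ≤ μ) {G M : Finset (ℕ × ℕ)}
    (hG : ∀ x ∈ G, x.1.Prime ∧ 1 ≤ x.2) (hM : ∀ x ∈ M, x.1.Prime ∧ 1 ≤ x.2)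
    (hdom : ∀ x ∈ G, ∀ y ∈ M, y ∉ G → itemDensity μ y ≤ itemDensity μ x) (hne : G.Nonempty) :
    ∃ d : ℝ, 0 < d ∧ ∑ x ∈ M, itemVal x - ∑ x ∈ G, itemVal x ≤
      d * (∑ x ∈ M, itemWeight μ x - ∑ x ∈ G, itemWeight μ x) := by
  have hwpos : ∀ x : ℕ × ℕ, x.1.Prime ∧ 1 ≤ x.2 → 0 < itemWeight μ x :=
    fun x hx => itemWeight_pos hμ hx.1 hx.2
  obtain ⟨x₀, hx₀, hmin⟩ := G.exists_min_image (itemDensity μ) hne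
  set d := itemDensity μ x₀ with hd
  refine ⟨d, div_pos (itemVal_pos (r := x₀.2) (hG x₀ hx₀).1) (hwpos _ (hG x₀ hx₀)), ?_⟩
  set e : ℕ × ℕ → ℝ := fun x => itemVal x - d * itemWeight μ x with he
  have hsum : ∀ S : Finset (ℕ × ℕ),
      ∑ x ∈ S, e x = ∑ x ∈ S, itemVal x - d * ∑ x ∈ S, itemWeight μ x := fun S => by
    rw [Finset.mul_sum, ← Finset.sum_sub_distrib]
  have heG : ∀ x ∈ G, 0 ≤ e x := fun x hx =>
    sub_nonneg.2 ((le_div_iff₀ (hwpos x (hG x hx))).1 (hmin x hx))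
  have heM : ∀ x ∈ M, x ∉ G → e x ≤ 0 := fun x hx hxG =>
    sub_nonpos.2 ((div_le_iff₀ (hwpos x (hM x hx))).1 (hdom x₀ hx₀ x hx hxG))
  have h1 : ∑ x ∈ M, e x ≤ ∑ x ∈ M ∩ G, e x := by
    rw [← Finset.sum_filter_add_sum_filter_not M (· ∈ G), Finset.filter_mem_eq_inter]
    have := Finset.sum_nonpos (s := M.filter (· ∉ G)) (f := e) fun x hx =>
      heM x (Finset.mem_filter.1 hx).1 (Finset.mem_filter.1 hx).2
    linarith
  have h2 : ∑ x ∈ M ∩ G, e x ≤ ∑ x ∈ G, e x :=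
    Finset.sum_le_sum_of_subset_of_nonneg Finset.inter_subset_right fun x hx _ => heG x hx
  have := h1.trans h2
  rw [hsum, hsum] at this
  linarith

/-- The items `(p, r)` with `p ^ r ∣ N`. -/
noncomputable def itemsOf (N : ℕ) : Finset (ℕ × ℕ) :=
  (N.primeFactors.sigma fun p => Finset.Icc 1 (N.factorization p)).map
    (Equiv.sigmaEquivProd ℕ ℕ).toEmbedding

theorem sum_itemsOf (N : ℕ) (g : ℕ × ℕ → ℝ) :
    ∑ x ∈ itemsOf N, g x =
      ∑ p ∈ N.primeFactors, ∑ r ∈ Finset.Icc 1 (N.factorization p), g (p, r) := by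
  rw [itemsOf, Finset.sum_map, Finset.sum_sigma]
  rfl

theorem prime_of_mem_itemsOf {N : ℕ} {x : ℕ × ℕ} (hx : x ∈ itemsOf N) :
    x.1.Prime ∧ 1 ≤ x.2 := by
  simp only [itemsOf, Finset.mem_map, Finset.mem_sigma] at hx
  obtain ⟨⟨p, r⟩, ⟨h1, h2⟩, rfl⟩ := hx
  exact ⟨Nat.prime_of_mem_primeFactors h1, (Finset.mem_Icc.1 h2).1⟩

theorem sum_itemVal_itemsOf (N : ℕ) : ∑ x ∈ itemsOf N, itemVal x = Real.logb 2 N := by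
  rw [sum_itemsOf, Real.logb, Real.log_nat_eq_sum_factorization, Finsupp.sum,
    Nat.support_factorization, Finset.sum_div]
  refine Finset.sum_congr rfl fun p _ => ?_
  simp [itemVal, Real.logb, mul_div_assoc]

theorem sum_itemWeight_itemsOf {μ : ℕ} (hμ : 1 ≤ μ) (N : ℕ) :
    ∑ x ∈ itemsOf N, itemWeight μ x =
      - Real.logb 2 (∏ p ∈ N.primeFactors, regBeta (1 / (p : ℝ)) (N.factorization p) μ) := by
  rw [sum_itemsOf, Real.logb_prod, ← Finset.sum_neg_distrib]
  · exact Finset.sum_congr rfl fun _ hp => sum_itemWeight (Nat.prime_of_mem_primeFactors hp) _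
  · exact fun _ hp => (regBeta_pos (one_div_prime_pos (Nat.prime_of_mem_primeFactors hp))
      (one_div_prime_lt_one (Nat.prime_of_mem_primeFactors hp)) _ hμ).ne'

theorem prod_regBeta_pos {μ : ℕ} (hμ : 1 ≤ μ) (N : ℕ) :
    0 < ∏ p ∈ N.primeFactors, regBeta (1 / (p : ℝ)) (N.factorization p) μ :=
  Finset.prod_pos fun _ hp => regBeta_pos (one_div_prime_pos (Nat.prime_of_mem_primeFactors hp))
    (one_div_prime_lt_one (Nat.prime_of_mem_primeFactors hp)) _ hμ

theorem two_zpow_neg_le_prod_iff {lam μ : ℕ} (hμ : 1 ≤ μ) (N : ℕ) :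
    (2 : ℝ) ^ (-(lam : ℤ)) ≤
      ∏ p ∈ N.primeFactors, regBeta (1 / (p : ℝ)) (N.factorization p) μ ↔
    ∑ x ∈ itemsOf N, itemWeight μ x ≤ lam := by
  rw [sum_itemWeight_itemsOf hμ, neg_le, Real.le_logb_iff_rpow_le one_lt_two
    (prod_regBeta_pos hμ N), ← Real.rpow_intCast]
  simp

theorem prod_le_two_zpow_neg_iff {lam μ : ℕ} (hμ : 1 ≤ μ) (N : ℕ) :
    ∏ p ∈ N.primeFactors, regBeta (1 / (p : ℝ)) (N.factorization p) μ ≤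
      (2 : ℝ) ^ (-(lam : ℤ)) ↔
    (lam : ℝ) ≤ ∑ x ∈ itemsOf N, itemWeight μ x := by
  rw [sum_itemWeight_itemsOf hμ, le_neg, Real.logb_le_iff_le_rpow one_lt_two
    (prod_regBeta_pos hμ N), ← Real.rpow_intCast]
  simp

/-- The weak form serves the threshold, the strict one the product bound. If nothing was popped, no
least density exists; then `λ ≤ 0` and the claim is direct. -/
theorem IsGreedyOutput.bounds {lam μ : ℕ} (hμ : 1 ≤ μ) {k : ℝ} (hk : IsGreedyOutput lam μ k)
    (N : ℕ) :
    (∑ x ∈ itemsOf N, itemWeight μ x ≤ lam → Real.logb 2 N ≤ k) ∧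
    (∑ x ∈ itemsOf N, itemWeight μ x < lam → Real.logb 2 N < k) := by
  obtain ⟨L, s, hL, hw, rfl⟩ := hk
  obtain ⟨-, hvalid, -, hdom⟩ := hL.sorted hμ
  rw [hL.w_eq_sum hμ] at hw
  rw [hL.v_eq_sum hμ, ← sum_itemVal_itemsOf]
  have hpos : ∀ x ∈ itemsOf N, 0 < itemWeight μ x := fun x hx =>
    itemWeight_pos hμ (prime_of_mem_itemsOf hx).1 (prime_of_mem_itemsOf hx).2
  rcases L.toFinset.eq_empty_or_nonempty with he | hne
  · rw [he, Finset.sum_empty] at hw ⊢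
    constructor
    · intro h
      rcases (itemsOf N).eq_empty_or_nonempty with he' | hne'
      · simp [he']
      · exact absurd (h.trans hw) (Finset.sum_pos hpos hne').not_ge
    · intro h
      exact absurd (h.trans_le hw) (Finset.sum_nonneg fun x hx => (hpos x hx).le).not_gt
  · obtain ⟨d, hd, hle⟩ := sum_itemVal_sub_le hμ (G := L.toFinset) (M := itemsOf N)
      (fun x hx => hvalid x (List.mem_toFinset.1 hx)) (fun x hx => prime_of_mem_itemsOf hx)
      (fun x hx y hy hyL => hdom x (List.mem_toFinset.1 hx) y.1 y.2 (prime_of_mem_itemsOf hy).1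
        (prime_of_mem_itemsOf hy).2 fun h => hyL (List.mem_toFinset.2 h)) hne
    constructor
    · intro h
      have := mul_nonpos_of_nonneg_of_nonpos hd.le (sub_nonpos.2 (h.trans hw))
      linarith
    · intro h
      have := mul_neg_of_pos_of_neg hd (sub_neg.2 (h.trans_le hw))
      linarith

theorem IsGreedyOutput.threshold_le {lam μ : ℕ} (hμ : 1 ≤ μ) {k : ℝ}
    (hk : IsGreedyOutput lam μ k) {N : ℕ} (hN : (2 : ℝ) ^ k ≤ N) : threshold lam μ ≤ N := by
  refine iSup₂_le fun N' hN' => ?_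
  have h := (hk.bounds hμ N').1 ((two_zpow_neg_le_prod_iff hμ N').1 hN'.2)
  rw [Real.logb_le_iff_le_rpow one_lt_two (by exact_mod_cast hN'.1)] at h
  exact_mod_cast h.trans hN

theorem IsGreedyOutput.prod_le {lam μ : ℕ} (hμ : 1 ≤ μ) {k : ℝ}
    (hk : IsGreedyOutput lam μ k) {N : ℕ} (hN : (2 : ℝ) ^ k ≤ N) :
    ∏ p ∈ N.primeFactors, regBeta (1 / (p : ℝ)) (N.factorization p) μ ≤
      (2 : ℝ) ^ (-(lam : ℤ)) := by
  rw [prod_le_two_zpow_neg_iff hμ]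
  by_contra! h
  have h := (hk.bounds hμ N).2 h
  have hpos : (0 : ℝ) < N := (Real.rpow_pos_of_pos two_pos k).trans_le hN
  rw [Real.logb_lt_iff_lt_rpow one_lt_two hpos] at h
  exact h.not_ge hN

/-! ### The multilinear Schwartz–Zippel lemma modulo a composite number -/

/-- The increments of the tail function `k ↦ I_ε(R - k, μ)`. -/
noncomputable def tailIncrement (ε : ℝ) (μ R j : ℕ) : ℝ :=
  if j = 0 then regBeta ε R μ else regBeta ε (R - j) μ - regBeta ε (R - j + 1) μ

theorem tailIncrement_nonneg {ε : ℝ} (h0 : 0 ≤ ε) (h1 : ε < 1) (μ R j : ℕ) :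
    0 ≤ tailIncrement ε μ R j := by
  unfold tailIncrement
  split_ifs
  · exact regBeta_nonneg h0 h1 _ _
  · exact sub_nonneg.2 (regBeta_succ_le h0 h1 _ _)

theorem sum_tailIncrement (ε : ℝ) (μ R : ℕ) {k : ℕ} (hk : k ≤ R) :
    ∑ j ∈ Finset.range (k + 1), tailIncrement ε μ R j = regBeta ε (R - k) μ := by
  induction k with
  | zero => simp [tailIncrement]
  | succ k ih =>
    rw [Finset.sum_range_succ, ih (by omega), tailIncrement, if_neg (by omega),
      show R - (k + 1) + 1 = R - k by omega]
    ring

/-- Convolution: for `j ≥ 1` the increment is `P(X = R - j)`, and `ε ^ j = P(Y ≥ j)` for one more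
geometric variable, so the sum is `P(X + Y ≥ R)`. -/
theorem sum_tailIncrement_mul_pow {ε : ℝ} (h0 : 0 ≤ ε) (h1 : ε < 1) (μ R : ℕ) :
    ∑ j ∈ Finset.range (R + 1), tailIncrement ε μ R j * ε ^ j = regBeta ε R (μ + 1) := by
  induction R with
  | zero => simp [tailIncrement, regBeta_zero h0 h1]
  | succ R ih =>
    rw [Finset.sum_range_succ'] at ih ⊢
    rw [Finset.sum_range_succ', regBeta_succ_succ h0 h1, ← ih]
    have : ∀ j ∈ Finset.range R, tailIncrement ε μ (R + 1) (j + 1 + 1) * ε ^ (j + 1 + 1) =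
        ε * (tailIncrement ε μ R (j + 1) * ε ^ (j + 1)) := fun j _ => by
      simp only [tailIncrement, Nat.add_eq_zero_iff, one_ne_zero, and_false, if_false,
        Nat.add_sub_add_right]
      ring
    rw [Finset.sum_congr rfl this, ← Finset.mul_sum]
    simp only [tailIncrement, zero_add, one_ne_zero, if_false, if_true, Nat.add_sub_cancel]
    ring

/-- A bound for the joint tails of several quantities carries over to products of monotone
functions of them. -/
theorem sum_prod_sum_ite_le {α ι : Type*} [Fintype ι] [DecidableEq ι] (T : Finset α)
    (D : ι → ℕ → α → Prop) [∀ i j t, Decidable (D i j t)] (h : ι → ℕ → ℝ)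
    (hh : ∀ i j, 0 ≤ h i j) (R : ι → ℕ) (q : ι → ℝ) (m : ℝ)
    (hD : ∀ φ : ι → ℕ, (∀ i, φ i ≤ R i) →
      ((T.filter fun t => ∀ i, D i (φ i) t).card : ℝ) ≤ 1 + m * ∏ i, q i ^ φ i) :
    ∑ t ∈ T, ∏ i, ∑ j ∈ Finset.range (R i + 1), (if D i j t then h i j else 0) ≤
      ∏ i, ∑ j ∈ Finset.range (R i + 1), h i j +
        m * ∏ i, ∑ j ∈ Finset.range (R i + 1), h i j * q i ^ j := by
  -- Expanding both products indexes everything by exponent vectors `φ`, and the sum over `t`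
  -- becomes a joint tail count for each `φ`.
  simp_rw [Finset.prod_univ_sum]
  rw [Finset.sum_comm, Finset.mul_sum, ← Finset.sum_add_distrib]
  refine Finset.sum_le_sum fun φ hφ => ?_
  have hφ : ∀ i, φ i ≤ R i := fun i => by
    have := Fintype.mem_piFinset.1 hφ i
    rw [Finset.mem_range] at this
    omega
  have e : ∑ t ∈ T, ∏ i, (if D i (φ i) t then h i (φ i) else 0) =
      (∏ i, h i (φ i)) * ((T.filter fun t => ∀ i, D i (φ i) t).card : ℝ) := by
    simp_rw [Finset.prod_ite_zero]
    simp only [Finset.mem_univ, true_imp_iff]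
    rw [← Finset.sum_filter, Finset.sum_const, nsmul_eq_mul, mul_comm]
  rw [e, Finset.prod_mul_distrib]
  calc _ ≤ (∏ i, h i (φ i)) * (1 + m * ∏ i, q i ^ φ i) :=
        mul_le_mul_of_nonneg_left (hD φ hφ) (Finset.prod_nonneg fun i _ => hh _ _)
    _ = _ := by ring

/-- A function of integers that is affine in each variable. -/
def IsMultiAffine {n : ℕ} (F : (Fin n → ℤ) → ℤ) : Prop :=
  ∀ i x, ∃ a b : ℤ, ∀ t, F (Function.update x i t) = a + b * t

theorem IsMultiAffine.cons {n : ℕ} {F : (Fin (n + 1) → ℤ) → ℤ} (hF : IsMultiAffine F) (t : ℤ) :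
    IsMultiAffine fun y => F (Fin.cons t y) := fun i x => by
  obtain ⟨a, b, h⟩ := hF i.succ (Fin.cons t x)
  exact ⟨a, b, fun s => (congrArg F (Fin.cons_update t x i s)).trans (h s)⟩

/-- The values at `0` and `1` are `a` and `a + b`, so `c` divides both coefficients. -/
theorem IsMultiAffine.of_mul {n : ℕ} {G : (Fin n → ℤ) → ℤ} {c : ℤ} (hc : c ≠ 0)
    (hF : IsMultiAffine fun y => c * G y) : IsMultiAffine G := fun i x => by
  obtain ⟨a, b, h⟩ := hF i x
  have ha : c ∣ a := ⟨_, by simpa using (h 0).symm⟩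
  have hb : c ∣ b := (Int.dvd_add_right ha).1 ⟨_, by simpa using (h 1).symm⟩
  obtain ⟨a', rfl⟩ := ha
  obtain ⟨b', rfl⟩ := hb
  refine ⟨a', b', fun t => mul_left_cancel₀ hc ?_⟩
  refine (h t).trans ?_
  ring

/-- Congruent integers are separated by their quotients by `e`, which lie in `[0, (m - 1) / e]`. -/
theorem card_le_of_modEq {e m : ℤ} (he : 0 < e) (hm : 1 ≤ m) (T : Finset ℤ)
    (hT : T ⊆ Finset.Ico 0 m) (h : ∀ t ∈ T, ∀ t' ∈ T, e ∣ t - t') :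
    (T.card : ℝ) ≤ 1 + m / e := by
  have hq : 0 ≤ (m - 1) / e := Int.ediv_nonneg (by omega) he.le
  have hcard : T.card ≤ (Finset.Icc 0 ((m - 1) / e)).card := by
    refine Finset.card_le_card_of_injOn (fun t => t / e) (fun t ht => ?_) fun t ht t' ht' heq => ?_
    · have := Finset.mem_Ico.1 (hT ht)
      exact Finset.mem_coe.2 (Finset.mem_Icc.2
        ⟨Int.ediv_nonneg this.1 he.le, Int.ediv_le_ediv he (by omega)⟩)
    · have h1 : t % e = t' % e :=
        Int.emod_eq_emod_iff_emod_sub_eq_zero.2 (Int.emod_eq_zero_of_dvd (h t ht t' ht'))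
      rw [← Int.emod_add_mul_ediv t e, ← Int.emod_add_mul_ediv t' e, h1]
      exact congrArg (fun z => t' % e + e * z) heq
  have hmul : (m - 1) / e * e ≤ m - 1 := Int.ediv_mul_le _ he.ne'
  have he' : (0 : ℝ) < e := by exact_mod_cast he
  have h2 : (((m - 1) / e : ℤ) : ℝ) ≤ m / e := by
    rw [le_div_iff₀ he']
    exact_mod_cast (show (m - 1) / e * e ≤ m by omega)
  have h3 : ((Finset.Icc 0 ((m - 1) / e)).card : ℝ) = ((m - 1) / e : ℤ) + 1 := by
    have : (((Finset.Icc 0 ((m - 1) / e)).card : ℤ)) = (m - 1) / e + 1 := by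
      rw [Int.card_Icc, Int.toNat_of_nonneg (by omega)]
      ring
    exact_mod_cast congrArg (Int.cast : ℤ → ℝ) this
  have h4 : (T.card : ℝ) ≤ (Finset.Icc 0 ((m - 1) / e)).card := by exact_mod_cast hcard
  linarith

theorem isCoprime_prime_pow {p q : ℕ} (hp : p.Prime) (hq : q.Prime) (hpq : p ≠ q) (a b : ℕ) :
    IsCoprime ((p : ℤ) ^ a) ((q : ℤ) ^ b) :=
  ((Nat.isCoprime_iff_coprime.2 ((Nat.coprime_primes hp hq).2 hpq)).pow_left).pow_right

theorem isCoprime_prime_pow_of_not_dvd {p : ℕ} (hp : p.Prime) {b : ℤ} (hb : ¬ (p : ℤ) ∣ b)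
    (a : ℕ) : IsCoprime ((p : ℤ) ^ a) b :=
  (((Nat.prime_iff_prime_int.1 hp).irreducible.coprime_iff_not_dvd).2 hb).pow_left

open Classical in
-- On a line through a point where `P i ∤ F`, write `F = a + b * t`. If `P i ∣ b`, any counted `t`
-- would force `P i ∣ a` and hence `P i ∣ F` there. So `b` is a unit modulo `P i ^ φ i`, and all
-- counted `t` are congruent modulo the product of these powers.
theorem card_forall_dvd_cons_le {ι : Type*} [Fintype ι] {P : ι → ℕ} (hP : ∀ i, (P i).Prime)
    (hinj : Function.Injective P) {n m : ℕ} (hm : 1 ≤ m) {F : (Fin (n + 1) → ℤ) → ℤ}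
    (hF : IsMultiAffine F) (φ : ι → ℕ) (hφ : ∀ i, 1 ≤ φ i → ∃ x, ¬ (P i : ℤ) ∣ F x) :
    (((Finset.Ico (0 : ℤ) m).filter fun t =>
      ∀ i y, (P i : ℤ) ^ φ i ∣ F (Fin.cons t y)).card : ℝ) ≤
      1 + m * ∏ i, (1 / (P i : ℝ)) ^ φ i := by
  have key := card_le_of_modEq (e := ∏ i, (P i : ℤ) ^ φ i) (m := m)
    (Finset.prod_pos fun i _ => pow_pos (by exact_mod_cast (hP i).pos) _) (by exact_mod_cast hm)
    _ (Finset.filter_subset (fun t => ∀ i y, (P i : ℤ) ^ φ i ∣ F (Fin.cons t y)) _) ?_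
  · refine key.trans (le_of_eq ?_)
    simp [div_eq_mul_inv]
  · intro t ht t' ht'
    have ht := (Finset.mem_filter.1 ht).2
    have ht' := (Finset.mem_filter.1 ht').2
    refine Finset.prod_dvd_of_coprime (fun i _ j _ hij =>
      isCoprime_prime_pow (hP i) (hP j) (hinj.ne hij) _ _) fun i _ => ?_
    rcases Nat.eq_zero_or_pos (φ i) with h0 | h0
    · simp [h0]
    obtain ⟨x, hx⟩ := hφ i h0
    obtain ⟨a, b, hab⟩ := hF 0 (Fin.cons (x 0) (Fin.tail x))
    simp only [Fin.update_cons_zero] at hab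
    have hb : ¬ (P i : ℤ) ∣ b := fun hb => hx <| by
      have h1 : (P i : ℤ) ∣ a + b * t :=
        hab t ▸ (dvd_pow_self _ (by omega)).trans (ht i (Fin.tail x))
      have h2 := (Int.dvd_add_left (hb.mul_right t)).1 h1
      rw [← Fin.cons_self_tail x, hab]
      exact dvd_add h2 (hb.mul_right _)
    have hsub : (P i : ℤ) ^ φ i ∣ b * (t - t') := by
      have := dvd_sub (ht i (Fin.tail x)) (ht' i (Fin.tail x))
      rw [hab, hab] at this
      rwa [show b * (t - t') = a + b * t - (a + b * t') by ring]
    exact (isCoprime_prime_pow_of_not_dvd (hP i) hb _).dvd_of_dvd_mul_left hsub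

theorem card_filter_cube_succ_le {n m : ℕ} (Q : (Fin (n + 1) → ℤ) → Prop) [DecidablePred Q] :
    ((cube (n + 1) m).filter Q).card ≤
      ∑ t ∈ Finset.Ico (0 : ℤ) m, ((cube n m).filter fun y => Q (Fin.cons t y)).card := by
  rw [Finset.card_eq_sum_card_fiberwise (f := fun x => x 0) (t := Finset.Ico (0 : ℤ) m)]
  · refine Finset.sum_le_sum fun t _ => ?_
    refine Finset.card_le_card_of_injOn Fin.tail (fun x hx => ?_) fun x hx x' hx' h => ?_
    · rw [Finset.mem_coe, Finset.mem_filter, Finset.mem_filter] at hx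
      obtain ⟨⟨hx, hQ⟩, rfl⟩ := hx
      rw [Finset.mem_coe, Finset.mem_filter, Fin.cons_self_tail]
      exact ⟨Fintype.mem_piFinset.2 fun i => Fintype.mem_piFinset.1 hx i.succ, hQ⟩
    · have hx := (Finset.mem_filter.1 hx).2
      have hx' := (Finset.mem_filter.1 hx').2
      rw [← Fin.cons_self_tail x, ← Fin.cons_self_tail x', h, hx, hx']
  · intro x hx
    exact Fintype.mem_piFinset.1 (Finset.mem_filter.1 hx).1 0

open Classical in
theorem card_forall_dvd_le {ι : Type*} [Fintype ι] {P : ι → ℕ} (hP : ∀ i, (P i).Prime)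
    (hinj : Function.Injective P) {m : ℕ} (hm : 1 ≤ m) (n : ℕ) :
    ∀ (r : ι → ℕ) (F : (Fin n → ℤ) → ℤ), IsMultiAffine F →
      (∀ i, 1 ≤ r i → ∃ x, ¬ (P i : ℤ) ∣ F x) →
      (((cube n m).filter fun x => ∀ i, (P i : ℤ) ^ r i ∣ F x).card : ℝ) ≤
        (m : ℝ) ^ n * (n / m + ∏ i, regBeta (1 / (P i : ℝ)) (r i) n) := by
  have h0 : ∀ i, 0 ≤ 1 / (P i : ℝ) := fun i => (one_div_prime_pos (hP i)).le
  have h1 : ∀ i, 1 / (P i : ℝ) < 1 := fun i => one_div_prime_lt_one (hP i)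
  have hm0 : (0 : ℝ) < m := by exact_mod_cast hm
  induction n with
  | zero =>
    intro r F _ hcop
    rw [pow_zero, one_mul, Nat.cast_zero, zero_div, zero_add]
    by_cases hr : ∀ i, r i = 0
    · simp only [hr, regBeta_zero (h0 _) (h1 _), Finset.prod_const_one]
      exact_mod_cast Finset.card_le_one.2 fun a _ b _ => Subsingleton.elim a b
    · push Not at hr
      obtain ⟨i, hi⟩ := hr
      obtain ⟨x, hx⟩ := hcop i (Nat.one_le_iff_ne_zero.2 hi)
      rw [Finset.filter_false_of_mem fun y _ hy => hx <| by
        rw [Subsingleton.elim x y]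
        exact (dvd_pow_self _ hi).trans (hy i)]
      rw [Finset.card_empty, Nat.cast_zero]
      exact Finset.prod_nonneg fun i _ => regBeta_nonneg (h0 i) (h1 i) _ _
  | succ n ih =>
    intro r F hF hcop
    set D : ι → ℕ → ℤ → Prop := fun i j t => ∀ y, (P i : ℤ) ^ j ∣ F (Fin.cons t y) with hD
    -- The exponent of `P i` in the restriction to first coordinate `t`, capped at `r i`.
    set k : ℤ → ι → ℕ := fun t i => Nat.findGreatest (fun j => D i j t) (r i) with hk
    have hk_le : ∀ t i, k t i ≤ r i := fun t i => Nat.findGreatest_le _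
    have hD_mono : ∀ i j j' t, j ≤ j' → D i j' t → D i j t := fun i j j' t hj h y =>
      (pow_dvd_pow _ hj).trans (h y)
    have hDk : ∀ t i, D i (k t i) t := fun t i =>
      Nat.findGreatest_spec (P := fun j => D i j t) (Nat.zero_le _) fun y => by simp
    have hD_iff : ∀ t i j, j ≤ r i → (D i j t ↔ j ≤ k t i) := fun t i j hj =>
      ⟨fun h => Nat.le_findGreatest hj h, fun h => hD_mono i j _ t h (hDk t i)⟩
    have fiber : ∀ t, (((cube n m).filter fun y =>
        ∀ i, (P i : ℤ) ^ r i ∣ F (Fin.cons t y)).card : ℝ) ≤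
          (m : ℝ) ^ n * (n / m + ∏ i, regBeta (1 / (P i : ℝ)) (r i - k t i) n) := fun t => by
      set c : ℤ := ∏ i, (P i : ℤ) ^ k t i with hc
      have hc0 : c ≠ 0 := Finset.prod_ne_zero_iff.2 fun i _ =>
        pow_ne_zero _ (by exact_mod_cast (hP i).ne_zero)
      have hdvd : ∀ y, c ∣ F (Fin.cons t y) := fun y =>
        Finset.prod_dvd_of_coprime (fun i _ j _ hij =>
          isCoprime_prime_pow (hP i) (hP j) (hinj.ne hij) _ _) fun i _ => hDk t i y
      choose G hG using hdvd
      have hGa : IsMultiAffine G := IsMultiAffine.of_mul hc0 (by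
        have := hF.cons t
        simpa only [hG] using this)
      have hci : ∀ i, ∃ c', c = (P i : ℤ) ^ k t i * c' ∧ ∀ a, IsCoprime ((P i : ℤ) ^ a) c' :=
        fun i => ⟨_, (Finset.mul_prod_erase _ _ (Finset.mem_univ i)).symm, fun a =>
          IsCoprime.prod_right fun j hj => isCoprime_prime_pow (hP i) (hP j)
            (hinj.ne (Finset.ne_of_mem_erase hj).symm) _ _⟩
      refine le_trans (Nat.cast_le.2 (Finset.card_le_card ?_))
        (ih (fun i => r i - k t i) G hGa fun i hi => ?_)
      · refine Finset.monotone_filter_right _ fun y _ hy i => ?_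
        obtain ⟨c', hc', hcop'⟩ := hci i
        have h := hy i
        rw [hG, hc', mul_assoc, ← Nat.add_sub_cancel' (hk_le t i), pow_add] at h
        exact (hcop' _).dvd_of_dvd_mul_left ((mul_dvd_mul_iff_left
          (pow_ne_zero _ (by exact_mod_cast (hP i).ne_zero))).1 h)
      -- A further factor `P i` common to all values of `G` would contradict the maximality of `k t
      -- i`, which here is below the cap.
      · by_contra! hall
        refine Nat.findGreatest_is_greatest (P := fun j => D i j t) (n := r i)
          (k := k t i + 1) (Nat.lt_succ_self _) (by omega) fun y => ?_
        obtain ⟨c', hc', -⟩ := hci i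
        rw [hG, hc', pow_succ]
        exact mul_dvd_mul (dvd_mul_right _ _) (hall y)
    have hsum : ∀ t, ∏ i, regBeta (1 / (P i : ℝ)) (r i - k t i) n =
        ∏ i, ∑ j ∈ Finset.range (r i + 1),
          (if D i j t then tailIncrement (1 / (P i : ℝ)) n (r i) j else 0) := fun t => by
      refine Finset.prod_congr rfl fun i _ => ?_
      rw [← sum_tailIncrement _ _ _ (hk_le t i), ← Finset.sum_filter]
      refine Finset.sum_congr ?_ fun _ _ => rfl
      ext j
      have := hk_le t i
      rw [Finset.mem_filter, Finset.mem_range, Finset.mem_range]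
      constructor
      · intro h
        exact ⟨by omega, (hD_iff t i j (by omega)).2 (by omega)⟩
      · rintro ⟨h, h'⟩
        have := (hD_iff t i j (by omega)).1 h'
        omega
    have hprod := sum_prod_sum_ite_le (Finset.Ico (0 : ℤ) m) D
      (fun i j => tailIncrement (1 / (P i : ℝ)) n (r i) j)
      (fun i j => tailIncrement_nonneg (h0 i) (h1 i) _ _ _) r (fun i => 1 / (P i : ℝ)) m
      fun φ hφ => card_forall_dvd_cons_le hP hinj hm hF φ fun i hi => hcop i (hi.trans (hφ i))
    simp only [sum_tailIncrement _ _ _ le_rfl, Nat.sub_self, regBeta_zero (h0 _) (h1 _),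
      sum_tailIncrement_mul_pow (h0 _) (h1 _), Finset.prod_const_one] at hprod
    calc _ ≤ ∑ t ∈ Finset.Ico (0 : ℤ) m, (((cube n m).filter fun y =>
          ∀ i, (P i : ℤ) ^ r i ∣ F (Fin.cons t y)).card : ℝ) := by
          exact (Nat.cast_le.2 (card_filter_cube_succ_le _)).trans_eq (Nat.cast_sum _ _)
      _ ≤ ∑ t ∈ Finset.Ico (0 : ℤ) m,
          (m : ℝ) ^ n * (n / m + ∏ i, regBeta (1 / (P i : ℝ)) (r i - k t i) n) :=
          Finset.sum_le_sum fun t _ => fiber t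
      _ = (m : ℝ) ^ n * (n + ∑ t ∈ Finset.Ico (0 : ℤ) m,
          ∏ i, regBeta (1 / (P i : ℝ)) (r i - k t i) n) := by
          rw [← Finset.mul_sum, Finset.sum_add_distrib, Finset.sum_const, Int.card_Ico]
          simp [mul_div_cancel₀ _ hm0.ne']
      _ ≤ (m : ℝ) ^ n * (n + (1 + m * ∏ i, regBeta (1 / (P i : ℝ)) (r i) (n + 1))) := by
          simp only [hsum]
          gcongr
      _ = _ := by
          push_cast
          field_simp
          ring

/-! ### Polynomials -/

theorem IsMuLinear.isMultiAffine {μ : ℕ} {f : MvPolynomial (Fin μ) ℤ} (hf : IsMuLinear f) :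
    IsMultiAffine fun x => MvPolynomial.eval x f := fun i x => by
  have term : ∀ d ∈ f.support, ∃ a b : ℤ, ∀ t : ℤ,
      f.coeff d * ∏ j, Function.update x i t j ^ d j = a + b * t := fun d hd => by
    have hdi : d i ≤ 1 := (MvPolynomial.monomial_le_degreeOf i hd).trans (hf i)
    have split : ∀ t : ℤ, ∏ j, Function.update x i t j ^ d j =
        t ^ d i * ∏ j ∈ Finset.univ.erase i, x j ^ d j := fun t => by
      rw [← Finset.mul_prod_erase _ _ (Finset.mem_univ i), Function.update_self]
      congr 1
      exact Finset.prod_congr rfl fun j hj => by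
        rw [Function.update_of_ne (Finset.ne_of_mem_erase hj)]
    rcases Nat.le_one_iff_eq_zero_or_eq_one.1 hdi with h | h
    · exact ⟨f.coeff d * ∏ j ∈ Finset.univ.erase i, x j ^ d j, 0, fun t => by
        rw [split, h]; ring⟩
    · exact ⟨0, f.coeff d * ∏ j ∈ Finset.univ.erase i, x j ^ d j, fun t => by
        rw [split, h]; ring⟩
  choose! a b hab using term
  refine ⟨∑ d ∈ f.support, a d, ∑ d ∈ f.support, b d, fun t => ?_⟩
  change MvPolynomial.eval _ f = _
  rw [MvPolynomial.eval_eq', Finset.sum_mul, ← Finset.sum_add_distrib]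
  exact Finset.sum_congr rfl fun d hd => hab d hd t

/-- Modulo `p` the polynomial vanishes on all of `ZMod p ^ μ` while its degree in each variable is
at most `1 < p`, so it is zero. -/
theorem IsMuLinear.dvd_coeff {μ : ℕ} {f : MvPolynomial (Fin μ) ℤ} (hf : IsMuLinear f) {p : ℕ}
    (hp : p.Prime) (h : ∀ x, (p : ℤ) ∣ MvPolynomial.eval x f) (d : Fin μ →₀ ℕ) :
    (p : ℤ) ∣ f.coeff d := by
  have := Fact.mk hp
  have hzero : MvPolynomial.map (Int.castRingHom (ZMod p)) f = 0 := by
    refine MvPolynomial.eq_zero_of_eval_zero_at_prod_finset _ (fun _ => Finset.univ)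
      (fun i => ?_) fun x _ => ?_
    · rw [Finset.card_univ, ZMod.card]
      refine lt_of_le_of_lt (MvPolynomial.degreeOf_le_iff.2 fun d hd => ?_) hp.one_lt
      exact (MvPolynomial.monomial_le_degreeOf i
        (MvPolynomial.support_map_subset _ _ hd)).trans (hf i)
    · choose y hy using fun i => ZMod.intCast_surjective (x i)
      obtain rfl : (Int.castRingHom (ZMod p)) ∘ y = x := funext hy
      have hcomp := MvPolynomial.eval₂_comp_left (Int.castRingHom (ZMod p)) (RingHom.id ℤ) y f
      rw [RingHom.comp_id] at hcomp
      rw [MvPolynomial.eval_map, ← hcomp]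
      exact (ZMod.intCast_zmod_eq_zero_iff_dvd _ p).2 (h y)
  have := congrArg (MvPolynomial.coeff d) hzero
  rw [MvPolynomial.coeff_map, MvPolynomial.coeff_zero] at this
  exact (ZMod.intCast_zmod_eq_zero_iff_dvd _ p).1 this

theorem exists_not_dvd_eval {μ : ℕ} {f : MvPolynomial (Fin μ) ℤ} (hf : IsMuLinear f) {N : ℕ}
    (hN : CoprimeTo f N) {p : ℕ} (hp : p.Prime) (hpN : p ∣ N) :
    ∃ x, ¬ (p : ℤ) ∣ MvPolynomial.eval x f := by
  by_contra! h
  have := hN.isUnit_of_dvd' (Finset.dvd_gcd fun d _ => hf.dvd_coeff hp h d)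
    (Int.natCast_dvd_natCast.2 hpN)
  exact (Nat.prime_iff_prime_int.1 hp).not_isUnit this

theorem modEq_zero_iff_forall_pow_dvd {N : ℕ} (hN : N ≠ 0) (a : ℤ) :
    a ≡ 0 [ZMOD N] ↔ ∀ p : N.primeFactors, ((p : ℕ) : ℤ) ^ N.factorization p ∣ a := by
  rw [Int.modEq_zero_iff_dvd]
  constructor
  · intro h p
    exact (by exact_mod_cast Nat.ordProj_dvd N p : ((p : ℕ) : ℤ) ^ N.factorization p ∣ N).trans h
  · intro h
    have e : ((∏ p ∈ N.primeFactors, p ^ N.factorization p : ℕ) : ℤ) = N := by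
      exact_mod_cast Nat.prod_factorization_pow_eq_self hN
    rw [← e, Nat.cast_prod]
    refine Finset.prod_dvd_of_coprime (fun p hp q hq hpq => ?_) fun p hp => ?_
    · have := isCoprime_prime_pow (Nat.prime_of_mem_primeFactors hp)
        (Nat.prime_of_mem_primeFactors hq) hpq (N.factorization p) (N.factorization q)
      simpa [Function.onFun] using this
    · exact_mod_cast h ⟨p, hp⟩

/-- The multilinear Schwartz–Zippel lemma modulo `N`. -/
theorem zeroProb_le {μ N m : ℕ} (hN : N ≠ 0) (hm : 1 ≤ m) {f : MvPolynomial (Fin μ) ℤ}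
    (hf : IsMuLinear f) (hfN : CoprimeTo f N) :
    zeroProb f N m ≤
      ∏ p ∈ N.primeFactors, regBeta (1 / (p : ℝ)) (N.factorization p) μ + (μ : ℝ) / m := by
  classical
  have key := card_forall_dvd_le (P := fun p : N.primeFactors => (p : ℕ))
    (fun p => Nat.prime_of_mem_primeFactors p.2) Subtype.val_injective hm μ
    (fun p => N.factorization p) _ hf.isMultiAffine fun p _ =>
      exists_not_dvd_eval hf hfN (Nat.prime_of_mem_primeFactors p.2)
        (Nat.dvd_of_mem_primeFactors p.2)
  have hcube : ((cube μ m).card : ℝ) = (m : ℝ) ^ μ := by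
    simp [cube, Fintype.card_piFinset]
  have hm0 : (0 : ℝ) < m := by exact_mod_cast hm
  unfold zeroProb
  rw [hcube, div_le_iff₀ (pow_pos hm0 _)]
  simp only [modEq_zero_iff_forall_pow_dvd hN]
  rw [← Finset.prod_coe_sort]
  refine le_trans (le_of_eq ?_) (key.trans (le_of_eq ?_))
  · congr!
  · ring

/-! ### The computational bound -/

theorem mainTheorem4 :
    -- the algorithm terminates with the claimed bound, for all positive `μ` and all `λ`
    (∀ lam μ : ℕ, 1 ≤ μ →
      (∃ n : ℕ, ∀ L s, GreedyRun lam μ L s → L.length ≤ n) ∧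
      (∀ L s, GreedyRun lam μ L s → s.w < lam → ∃ x, IsHeapMax μ s x) ∧
      (∃ k : ℝ, IsGreedyOutput lam μ k) ∧
      ∀ k : ℝ, IsGreedyOutput lam μ k → ∀ N : ℕ, (2 : ℝ) ^ k ≤ N →
        threshold lam μ ≤ N ∧
        ∀ m : ℕ, 1 ≤ m → ∀ f : MvPolynomial (Fin μ) ℤ, IsMuLinear f → CoprimeTo f N →
          zeroProb f N m ≤ (2 : ℝ) ^ (-(lam : ℤ)) + (μ : ℝ) / m) ∧
    -- positivity and monotonicity of the density
    (∀ μ : ℕ, 1 ≤ μ →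
      (∀ p r : ℕ, p.Prime → 1 ≤ r → 0 < itemWeight μ (p, r)) ∧
      (∀ p : ℕ, p.Prime → AntitoneOn (fun r => itemDensity μ (p, r)) (Set.Ici 1)) ∧
      (2 ≤ μ → ∀ p : ℕ, p.Prime → StrictAntiOn (fun r => itemDensity μ (p, r)) (Set.Ici 1)) ∧
      AntitoneOn (fun p => itemDensity μ (p, 1)) {p : ℕ | p.Prime}) ∧
    -- the enumeration scheme lists pairs in non-increasing order
    (∀ (A B : Type*) [LinearOrder A] [OrderBot A] [SuccOrder A]
      [LinearOrder B] [OrderBot B] [SuccOrder B] (f : A × B → ℝ),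
      Antitone (fun a => f (a, ⊥)) → (∀ a, Antitone fun b => f (a, b)) →
      ∀ L s, EnumRun f L s →
        L.Nodup ∧ L.Pairwise (fun x y => f y ≤ f x) ∧
        (∀ x ∈ L, ∀ y, y ∉ L → f y ≤ f x) ∧
        ((∃ y, y ∉ L) → ∃ x ∈ s.C, ∀ y ∈ s.C, f y ≤ f x)) ∧
    -- in particular, the algorithm pops the items in order of non-increasing density
    (∀ lam μ : ℕ, 1 ≤ μ → ∀ L s, GreedyRun lam μ L s →
      L.Nodup ∧ (∀ x ∈ L, x.1.Prime ∧ 1 ≤ x.2) ∧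
      L.Pairwise (fun x y => itemDensity μ y ≤ itemDensity μ x) ∧
      ∀ x ∈ L, ∀ p r : ℕ, p.Prime → 1 ≤ r → (p, r) ∉ L →
        itemDensity μ (p, r) ≤ itemDensity μ x) := by
  refine ⟨fun lam μ hμ => ⟨exists_greedyRun_length_le lam hμ, fun L s h _ => h.exists_isHeapMax hμ,
    exists_isGreedyOutput lam hμ, fun k hk N hN => ⟨hk.threshold_le hμ hN, fun m hm f hf hfN => ?_⟩⟩,
    fun μ hμ => ⟨fun p r hp hr => itemWeight_pos hμ hp hr, fun p hp => itemDensity_antitoneOn hμ hp,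
      fun h2 p hp => itemDensity_strictAntiOn h2 hp, itemDensity_one_antitoneOn hμ⟩, ?_,
    fun lam μ hμ L s h => h.sorted hμ⟩
  · have hN0 : N ≠ 0 := by
      rintro rfl
      exact (Real.rpow_pos_of_pos two_pos k).not_ge (by simpa using hN)
    exact (zeroProb_le hN0 hm hf hfN).trans (add_le_add_left (hk.prod_le hμ hN) _)
  · intro A B _ _ _ _ _ _ f hA hB L s h
    have hinv := h.inv hA hB
    exact ⟨hinv.nodup, hinv.sorted, hinv.dominates, hinv.exists_max⟩
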